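/- **Definition of the tile.** Let $\omega=e^{i\pi/3}$ and consider the grid of closed unit triangles in the plane $\mathbb C$ with vertex set $\mathbb Z+\mathbb Z\omega$. Let $H$ be the regular hexagon with vertices $3\omega^k$ ($0\le k\le 5$), a union of 54 grid triangles; its side $k$ joins $3\omega^k$ to $3\omega^{k+1}$. At side $k$, the *outer bump* (*inner bump*) is the grid triangle on the middle third of that side lying outside (inside) $H$. The *male joint* at side $k$ is the trapezoid consisting of the outer bump and the two grid triangles that share its other two edges; the *female joint* at side $k$ is the mirror image of this trapezoid in the side, so it lies inside $H$. HexToo consists of two layers lying one on top of the other: * the top layer is $H$ with the outer bumps added at the sides $0,1,4$ and the inner bumps removed at the sides $2,3,5$; * the bottom layer is $H$ with the female joints removed at the sides $2,3,5$ and one male joint added at side $0$. **Tilings.** A tiling by HexToo is a set of copies of the two-layer tile under orientation-preserving isometries of the plane (translations and rotations by arbitrary angles, the top layer always lying above the bottom layer) such that 1. the top layers cover the plane, and the top layers of distinct copies have disjoint interiors; 2. the bottom layers of distinct copies have disjoint interiors; 3. the copies can be laid from above: every finite subset of the copies can be ordered $t_1,\dots,t_n$ such that, for all $i<j$, the interior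 of the bottom layer of $t_j$ does not meet the interior of the top layer of $t_i$ (the bottom layer of a tile cannot be put below the top layer of a tile that already lies there). **Theorem.** HexToo is an aperiodic monotile: there is a tiling of the plane by HexToo, and no tiling of the plane by HexToo is mapped to itself by a translation by a nonzero vector. -/

import Mathlib

noncomputable section

namespace HexToo

/-! ## The unit triangular grid in the plane `ℂ` -/

/-- The primitive sixth root of unity `1/2 + (√3/2) i`. -/
def omega : ℂ := ⟨1 / 2, Real.sqrt 3 / 2⟩

/-- The point of the triangular grid with coordinates `(m, n)`, namely `m + n ω`. -/
def gridPoint (m n : ℤ) : ℂ := (m : ℂ) + (n : ℂ) * omega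

/-- A cell of the triangular grid is one of its closed unit triangles:
`up m n` has the vertices `(m, n)`, `(m+1, n)`, `(m, n+1)`, and
`down m n` has the vertices `(m+1, n)`, `(m, n+1)`, `(m+1, n+1)`. -/
inductive Cell where
  | up (m n : ℤ) : Cell
  | down (m n : ℤ) : Cell
  deriving DecidableEq

/-- The closed triangle that a cell occupies. -/
def Cell.triangle : Cell → Set ℂ
  | .up m n => convexHull ℝ {gridPoint m n, gridPoint (m + 1) n, gridPoint m (n + 1)}
  | .down m n =>
      convexHull ℝ {gridPoint (m + 1) n, gridPoint m (n + 1), gridPoint (m + 1) (n + 1)}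

/-- Rotation of the grid about the origin by 60 degrees counterclockwise,
`(m, n) ↦ (-n, m + n)` on grid points, that is, multiplication by `ω`. -/
def Cell.rotate : Cell → Cell
  | .up m n => .down (-n - 1) (m + n)
  | .down m n => .up (-n - 1) (m + n + 1)

/-- The plane region covered by finitely many cells. -/
def region (s : Finset Cell) : Set ℂ := ⋃ c ∈ s, c.triangle

/-! ## The two layers of the tile

The base is the regular hexagon of side `3` with vertices `3 ω ^ k`. Its side `k` joins `3 ω ^ k` to
`3 ω ^ (k + 1)`; it is obtained from side `0` by `k` rotations. -/

/-- The 54 cells of the base hexagon. -/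
def hexagon : Finset Cell :=
  (((Finset.Icc (-3 : ℤ) 2 ×ˢ Finset.Icc (-3 : ℤ) 2).filter
      (fun p => -3 ≤ p.1 + p.2 ∧ p.1 + p.2 ≤ 2)).image (fun p => Cell.up p.1 p.2)) ∪
  (((Finset.Icc (-3 : ℤ) 2 ×ˢ Finset.Icc (-3 : ℤ) 2).filter
      (fun p => -4 ≤ p.1 + p.2 ∧ p.1 + p.2 ≤ 1)).image (fun p => Cell.down p.1 p.2))

/-- `s` rotated by `k` times 60 degrees. -/
def turn (k : ℕ) (s : Finset Cell) : Finset Cell := s.image (Cell.rotate^[k])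

/-- Outer bump: the unit triangle erected outwards on the middle third of side `k`. -/
def bump (k : ℕ) : Finset Cell := turn k {.down 1 1}

/-- Inner bump: the unit triangle erected inwards on the middle third of side `k`. -/
def dent (k : ℕ) : Finset Cell := turn k {.up 1 1}

/-- Male joint at side `k`: a trapezoid outside the hexagon, made of the outer bump and the two
cells next to it in the row of cells along side `k`. -/
def male (k : ℕ) : Finset Cell := turn k {.down 1 1, .up 2 1, .up 1 2}

/-- Female joint at side `k`: the mirror image of `male k` in side `k`, a trapezoid inside the
hexagon. -/
def female (k : ℕ) : Finset Cell := turn k {.up 1 1, .down 1 0, .down 0 1}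

/-- The top layer: the hexagon with outer bumps on the sides `0, 1, 4` and inner bumps on the sides
`2, 3, 5`. -/
def topCells : Finset Cell :=
  (hexagon \ (dent 2 ∪ dent 3 ∪ dent 5)) ∪ (bump 0 ∪ bump 1 ∪ bump 4)

/-- The bottom layer: the hexagon with female joints cut out at the sides `2, 3, 5`, and with one
male joint added at side `0`. -/
def bottomCells : Finset Cell :=
  (hexagon \ (female 2 ∪ female 3 ∪ female 5)) ∪ male 0

/-! ## Placed tiles and tilings -/

/-- A position of the tile in the plane, lying on its bottom layer: the image of the tile
under the orientation-preserving isometry `z ↦ rot * z + shift`. -/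
@[ext]
structure Placement where
  rot : Circle
  shift : ℂ

/-- The orientation-preserving isometry of the plane that belongs to a placement. -/
def Placement.map (x : Placement) (z : ℂ) : ℂ := (x.rot : ℂ) * z + x.shift

/-- The region of the upper level occupied by a placed tile. -/
def Placement.top (x : Placement) : Set ℂ := x.map '' region topCells

/-- The region of the lower level occupied by a placed tile. -/
def Placement.bottom (x : Placement) : Set ℂ := x.map '' region bottomCells

/-- The placed tile, translated by `p`. -/
def Placement.translate (p : ℂ) (x : Placement) : Placement := ⟨x.rot, x.shift + p⟩

/-- Tiles are put down from above. Once `x` is lying in the plane, the tile `y` cannot be put down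
any more if a part of the bottom layer of `y` would have to get below the top layer of `x`. -/
def Obstructs (x y : Placement) : Prop := (interior x.top ∩ interior y.bottom).Nonempty

/-- The finitely many placed tiles in `F` can be put down one at a time, in the order of a suitable
list, such that no tile is obstructed by a tile put down before it. -/
def CanBeLaid (F : Finset Placement) : Prop :=
  ∃ l : List Placement, l.Nodup ∧ (∀ x, x ∈ l ↔ x ∈ F) ∧ l.Pairwise (fun x y => ¬ Obstructs x y)

/-- A tiling of the plane by the two-layer tile. -/
structure IsTiling (T : Set Placement) : Prop where
  /-- The top layers cover the plane. -/
  cover : ⋃ x ∈ T, x.top = Set.univ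
  /-- The top layers do not overlap. -/
  top_disjoint : T.Pairwise (fun x y => Disjoint (interior x.top) (interior y.top))
  /-- The bottom layers do not overlap. -/
  bottom_disjoint : T.Pairwise (fun x y => Disjoint (interior x.bottom) (interior y.bottom))
  /-- Any finite part of the tiling can be laid tile by tile. -/
  laid : ∀ F : Finset Placement, (F : Set Placement) ⊆ T → CanBeLaid F

/-- The translation by `p` maps the tiling to itself. -/
def IsPeriod (T : Set Placement) (p : ℂ) : Prop := Placement.translate p '' T = T

end HexToo

end

/-!
A tiling by HexToo amounts to an orientation `d x : ZMod 6` for each cell `x` of the lattice of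
hexagons such that bumps meet dents along all edges, and such that the arrows, which point from
each tile to the neighbour whose top layer lies on its male joint, never lead around a cycle
(`ValidOn`).

*From tilings to orientations.* Tiles may be placed anywhere in the plane, so that it has to be
shown that they lie on a common lattice. At the tip of a dent, and at a vertex of the hexagon
between a side with a bump and a neighbour already known, the plane is covered except for a corner
that is bounded by two unit triangles. As there are only finitely many tiles nearby
(`IsTiling.locallyFinite`) and a unit triangle fits into such a corner in one position only
(`unitTriangle_in_corner`), the tile that fills the corner lies on the grid
(`IsTiling.fill_zero`), and then only finitely many positions remain; all overlap with given tiles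
except those at the neighbouring cell of the lattice (`dent_check`, `bump_check`). So every tile
has six neighbours on the lattice (`IsTiling.neighbor`); there is no room for further tiles, since
the centres of tiles keep a distance of more than `3` (`IsTiling.le_dist`), while no point of the
plane is farther than `3` from the centre of a lattice cell (`exists_dist_center_le`). Bumps meet
dents, and since the tiles along a cycle of arrows could not be laid in any order, the
orientations are valid (`IsTiling.validOn`).

*Valid orientations have no period.* Modulo reversal there are three kinds of orientations, one
for each axis of the lattice. The matching rule alone says little more than that adjacent cells
have the same axis only along that axis. Say that a cell has a fault if the cells at 60 degrees to
the left and to the right of its arrow have the same axis. Without faults, the cells all of whose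
neighbours point along the lines through them ("hubs") form a sublattice of index four, which
carries a valid pattern itself, as arrows pass straight through the cells between hubs. A period
maps hubs to hubs, so that it is twice a period of the smaller pattern, and descent applies. At a
fault, on the other hand, acyclicity forces the next cell to continue the arrow, lest three arrows
form a triangle (`ValidOn.arrow_continues`), and so there is an infinite straight ray of arrows
(`ValidOn.ray_of_fault`). On one side of such a ray the hubs form a sublattice again, of which the
ray is a part (`AboveRay.half`). By descent, no parallel row is eventually directed along the ray
(`AboveRay.not_eventuallyAxial`), and there is no period along the ray (`AboveRay.not_periodic`);
the first excludes all periods in other directions.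

*A tiling.* Conversely, the hierarchy of hubs is a recipe: `orient` repeats itself on the even
cells, and a cell between two even ones points along the line through these, in the direction that
the matching rule asks for. Two steps along the arrows from an even cell `2 y` amount to one step
from `y`, so that a cycle would give one of half the length (`next_iterate_ne`).
-/

noncomputable section

open Relation

namespace HexToo

/-! ### Orientation patterns on the hexagonal lattice -/

/-- The six neighbours of the origin in the hexagonal lattice `ℤ × ℤ`, in counterclockwise order. -/
def dir (k : ZMod 6) : ℤ × ℤ :=
  (![(1, 0), (0, 1), (-1, 1), (-1, 0), (0, -1), (1, -1)] : Fin 6 → ℤ × ℤ) k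

/-- Whether the side facing direction `k` of a tile with orientation `d` carries a bump. -/
def isOut (d k : ZMod 6) : Bool := k == d || k == d + 1 || k == d + 4

/-- Whether the orientation `d` points along the axis of the direction `k`, forwards or backwards.
The orientations modulo this relation are three colours, one for each axis. -/
def onAxis (d k : ZMod 6) : Bool := d == k || d == k + 3

/-- From a cell, step to the neighbour in front of its arrow, staying inside `S`. In terms of tiles,
this is the neighbour into which the male joint reaches. -/
def StepOn (S : Set (ℤ × ℤ)) (d : ℤ × ℤ → ZMod 6) (x y : ℤ × ℤ) : Prop :=
  x ∈ S ∧ y ∈ S ∧ y = x + dir (d x)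

/-- The orientations `d` fit together on the set `S` of lattice cells: each side shared by two cells
carries a bump of exactly one of them, and following the arrows never leads around a cycle. -/
structure ValidOn (S : Set (ℤ × ℤ)) (d : ℤ × ℤ → ZMod 6) : Prop where
  matched : ∀ x ∈ S, ∀ k, x + dir k ∈ S → isOut (d x) k ≠ isOut (d (x + dir k)) (k + 3)
  acyclic : ∀ x, ¬ TransGen (StepOn S d) x x

@[simp] lemma dir_zero : dir 0 = (1, 0) := rfl
@[simp] lemma dir_one : dir 1 = (0, 1) := rfl
@[simp] lemma dir_two : dir 2 = (-1, 1) := rfl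
@[simp] lemma dir_three : dir 3 = (-1, 0) := rfl
@[simp] lemma dir_four : dir 4 = (0, -1) := rfl
@[simp] lemma dir_five : dir 5 = (1, -1) := rfl

lemma dir_add_three (k : ZMod 6) : dir (k + 3) = -dir k := by revert k; decide

lemma dir_add_dir_add_two (k : ZMod 6) : dir k + dir (k + 2) = dir (k + 1) := by revert k; decide

lemma add_dir_add_two (x : ℤ × ℤ) (k : ZMod 6) : x + dir k + dir (k + 2) = x + dir (k + 1) := by
  rw [add_assoc, dir_add_dir_add_two]

lemma add_dir_add_three (x : ℤ × ℤ) (k : ZMod 6) : x + dir k + dir (k + 3) = x := by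
  rw [dir_add_three]; abel

lemma ValidOn.mono {S S' : Set (ℤ × ℤ)} {d : ℤ × ℤ → ZMod 6} (h : ValidOn S d) (hS : S' ⊆ S) :
    ValidOn S' d :=
  ⟨fun x hx k hk => h.matched x (hS hx) k (hS hk),
    fun x hx => h.acyclic x (TransGen.mono (fun _ _ hab => ⟨hS hab.1, hS hab.2.1, hab.2.2⟩) _ _ hx)⟩

/-- Adjacent cells have the same colour only along the axis of that colour. -/
lemma ValidOn.onAxis_of_same {S : Set (ℤ × ℤ)} {d : ℤ × ℤ → ZMod 6} (h : ValidOn S d)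
    {x : ℤ × ℤ} {k : ZMod 6} (hx : x ∈ S) (hy : x + dir k ∈ S)
    (hc : onAxis (d x) (d (x + dir k))) : onAxis (d x) k := by
  have key : ∀ a b k : ZMod 6, isOut a k ≠ isOut b (k + 3) → onAxis a b → onAxis a k := by decide
  exact key _ _ _ (h.matched x hx k hy) hc

/-- If the two cells beside the arrow of `x`, at `60` degrees to its left and to its right, have the
same colour, then the cell in front of the arrow continues it: otherwise there is a cycle of three
arrows through `x`. -/
lemma ValidOn.arrow_continues {S : Set (ℤ × ℤ)} {d : ℤ × ℤ → ZMod 6} (h : ValidOn S d)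
    {x : ℤ × ℤ} (hx : x ∈ S) (h0 : x + dir (d x) ∈ S) (h1 : x + dir (d x + 1) ∈ S)
    (h5 : x + dir (d x + 5) ∈ S)
    (hc : onAxis (d (x + dir (d x + 1))) (d (x + dir (d x + 5)))) :
    d (x + dir (d x)) = d x := by
  have key : ∀ e r u l : ZMod 6, isOut e e ≠ isOut r (e + 3) →
      isOut e (e + 1) ≠ isOut u (e + 1 + 3) → isOut e (e + 5) ≠ isOut l (e + 5 + 3) →
      isOut r (e + 2) ≠ isOut u (e + 2 + 3) → isOut l (e + 1) ≠ isOut r (e + 1 + 3) →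
      onAxis u l → r ≠ e → r = e + 4 ∧ l = e + 2 := by decide
  by_contra hr
  have e1 : x + dir (d x) + dir (d x + 2) = x + dir (d x + 1) := add_dir_add_two x (d x)
  have e2 : x + dir (d x + 5) + dir (d x + 1) = x + dir (d x) := by
    have := add_dir_add_two x (d x + 5)
    rwa [show d x + 5 + 2 = d x + 1 by generalize d x = e; revert e; decide,
      show d x + 5 + 1 = d x by generalize d x = e; revert e; decide] at this
  have m1 := h.matched _ h0 (d x + 2) (e1 ▸ h1)
  have m2 := h.matched _ h5 (d x + 1) (e2 ▸ h0)
  rw [e1] at m1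
  rw [e2] at m2
  obtain ⟨hr4, hl2⟩ := key _ _ _ _ (h.matched x hx _ h0) (h.matched x hx _ h1)
    (h.matched x hx _ h5) m1 m2 hc hr
  have s1 : StepOn S d x (x + dir (d x)) := ⟨hx, h0, rfl⟩
  have s2 : StepOn S d (x + dir (d x)) (x + dir (d x + 5)) := by
    refine ⟨h0, h5, ?_⟩
    rw [hr4, add_assoc]
    congr 1
    generalize d x = e; revert e; decide
  have s3 : StepOn S d (x + dir (d x + 5)) x := by
    refine ⟨h5, hx, ?_⟩
    rw [hl2, add_assoc]
    have : dir (d x + 5) + dir (d x + 2) = 0 := by generalize d x = e; revert e; decide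
    rw [this, add_zero]
  exact h.acyclic x (((TransGen.single s1).tail s2).tail s3)

/-! ### Passing to a sublattice of index four -/

/-- If the cells halfway between neighbouring cells of a sublattice all point along the line that
joins these, then the sublattice carries a valid pattern itself: arrows pass straight through the
cells in between. -/
lemma ValidOn.comp {S S' : Set (ℤ × ℤ)} {d : ℤ × ℤ → ZMod 6} (h : ValidOn S d)
    (φ : ℤ × ℤ → ℤ × ℤ) (hφ : ∀ x k, φ (x + dir k) = φ x + dir k + dir k)
    (hS : ∀ x ∈ S', φ x ∈ S)
    (hmid : ∀ x ∈ S', ∀ k, x + dir k ∈ S' → φ x + dir k ∈ S ∧ onAxis (d (φ x + dir k)) k) :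
    ValidOn S' (d ∘ φ) := by
  have key : ∀ a m b k : ZMod 6, isOut a k ≠ isOut m (k + 3) → isOut m k ≠ isOut b (k + 3) →
    onAxis m k → isOut a k ≠ isOut b (k + 3) := by decide
  have key2 : ∀ a m : ZMod 6, isOut a a ≠ isOut m (a + 3) → onAxis m a → m = a := by decide
  refine ⟨fun x hx k hk => ?_, fun x hx => ?_⟩
  · obtain ⟨hm, ha⟩ := hmid x hx k hk
    have m2 := h.matched _ hm k (hφ x k ▸ hS _ hk)
    rw [← hφ] at m2
    exact key _ _ _ _ (h.matched _ (hS x hx) k hm) m2 ha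
  · refine h.acyclic (φ x) (TransGen.lift' φ (fun a b hab => ?_) _ _ hx)
    obtain ⟨ha, hb, rfl⟩ := hab
    obtain ⟨hm, hax⟩ := hmid a ha _ hb
    simp only [Function.comp_apply] at hm hax hb ⊢
    have hd := key2 _ _ (h.matched _ (hS a ha) _ hm) hax
    refine (TransGen.single ⟨hS a ha, hm, rfl⟩).tail ⟨hm, hS _ hb, ?_⟩
    rw [hd, hφ]

/-! ### Patterns without faults are hierarchical -/

/-- A cell all of whose neighbours point along the lines through that cell. -/
def Hub (d : ℤ × ℤ → ZMod 6) (x : ℤ × ℤ) : Prop := ∀ k, onAxis (d (x + dir k)) k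

/-- A fault at `x`: the two cells at `60` degrees to the left and right of the arrow of `x` have the
same colour. -/
def Fault (d : ℤ × ℤ → ZMod 6) (x : ℤ × ℤ) : Prop :=
  onAxis (d (x + dir (d x + 1))) (d (x + dir (d x + 5)))

section pattern

variable {d : ℤ × ℤ → ZMod 6}

lemma ValidOn.not_same (h : ValidOn Set.univ d) {x : ℤ × ℤ} {k : ZMod 6}
    (hk : ¬ onAxis (d x) k) : ¬ onAxis (d x) (d (x + dir k)) :=
  fun hc => hk (h.onAxis_of_same trivial trivial hc)

/-- Where there is no fault, a cell is a hub, or else off its own axis it has only neighbours of the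
colour that is neither its own nor that of the connecting line. -/
lemma ValidOn.hub_or (h : ValidOn Set.univ d) {x : ℤ × ℤ} (hf : ¬ Fault d x) :
    Hub d x ∨ ∀ k, ¬ onAxis (d x) k →
      ¬ onAxis (d (x + dir k)) k ∧ ¬ onAxis (d (x + dir k)) (d x) := by
  have key : ∀ e g1 g5 : ZMod 6, ¬ onAxis e g1 → ¬ onAxis e g5 → ¬ onAxis g1 g5 →
      (onAxis g1 (e + 1) ∧ onAxis g5 (e + 5)) ∨ (onAxis g1 (e + 2) ∧ onAxis g5 (e + 4)) := by
    decide
  have key' : ∀ e g g' : ZMod 6, ¬ onAxis e g' → (onAxis g' g → onAxis g' e) →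
      (onAxis g (e + 1) → onAxis g' (e + 2)) ∧ (onAxis g (e + 2) → onAxis g' (e + 1)) ∧
      (onAxis g (e + 5) → onAxis g' (e + 4)) ∧ (onAxis g (e + 4) → onAxis g' (e + 5)) := by
    decide
  have key2 : ∀ e g1 g5 g0 : ZMod 6, onAxis g1 (e + 1) → onAxis g5 (e + 5) →
      (onAxis g0 g1 → onAxis g0 (e + 2)) → (onAxis g0 g5 → onAxis g0 (e + 4)) →
      onAxis g0 e := by decide
  have key3 : ∀ e g2 g4 g3 : ZMod 6, onAxis g2 (e + 2) → onAxis g4 (e + 4) →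
      (onAxis g3 g2 → onAxis g3 (e + 1)) → (onAxis g3 g4 → onAxis g3 (e + 5)) →
      onAxis g3 (e + 3) := by decide
  have hall : ∀ P : ZMod 6 → Prop, ∀ e, P e → P (e + 1) → P (e + 2) → P (e + 3) → P (e + 4) →
      P (e + 5) → ∀ k, P k := by
    intro P e h0 h1 h2 h3 h4 h5 k
    have : k = e ∨ k = e + 1 ∨ k = e + 2 ∨ k = e + 3 ∨ k = e + 4 ∨ k = e + 5 := by
      clear h0 h1 h2 h3 h4 h5 hf
      revert k e; decide
    rcases this with rfl | rfl | rfl | rfl | rfl | rfl <;> assumption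
  have edge : ∀ i j : ZMod 6, ∀ l, dir i + dir l = dir j →
      onAxis (d (x + dir i)) (d (x + dir j)) → onAxis (d (x + dir i)) l := by
    intro i j l hij hc
    rw [← hij, ← add_assoc] at hc
    exact h.onAxis_of_same trivial trivial hc
  set e := d x with he
  have n1 : ¬ onAxis e (d (x + dir (e + 1))) :=
    h.not_same (by rw [← he]; generalize e = e; revert e; decide)
  have n2 : ¬ onAxis e (d (x + dir (e + 2))) :=
    h.not_same (by rw [← he]; generalize e = e; revert e; decide)
  have n4 : ¬ onAxis e (d (x + dir (e + 4))) :=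
    h.not_same (by rw [← he]; generalize e = e; revert e; decide)
  have n5 : ¬ onAxis e (d (x + dir (e + 5))) :=
    h.not_same (by rw [← he]; generalize e = e; revert e; decide)
  have c21 := edge (e + 2) (e + 1) e (by generalize e = e; revert e; decide)
  have c45 := edge (e + 4) (e + 5) e (by generalize e = e; revert e; decide)
  rcases key e _ _ n1 n5 hf with ⟨a1, a5⟩ | ⟨a1, a5⟩
  · left
    have a2 := (key' e _ _ n2 c21).1 a1
    have a4 := (key' e _ _ n4 c45).2.2.1 a5
    refine hall (fun k => onAxis (d (x + dir k)) k) e ?_ a1 a2 ?_ a4 a5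
    · exact key2 e _ _ _ a1 a5
        (edge e (e + 1) (e + 2) (by generalize e = e; revert e; decide))
        (edge e (e + 5) (e + 4) (by generalize e = e; revert e; decide))
    · exact key3 e _ _ _ a2 a4
        (edge (e + 3) (e + 2) (e + 1) (by generalize e = e; revert e; decide))
        (edge (e + 3) (e + 4) (e + 5) (by generalize e = e; revert e; decide))
  · right
    have a2 := (key' e _ _ n2 c21).2.1 a1
    have a4 := (key' e _ _ n4 c45).2.2.2 a5
    have fin : ∀ e g i : ZMod 6, (i = 1 ∧ onAxis g (e + 2)) ∨ (i = 2 ∧ onAxis g (e + 1)) ∨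
        (i = 4 ∧ onAxis g (e + 5)) ∨ (i = 5 ∧ onAxis g (e + 4)) →
        ¬ onAxis g (e + i) ∧ ¬ onAxis g e := by decide
    refine hall (fun k => ¬ onAxis e k →
        ¬ onAxis (d (x + dir k)) k ∧ ¬ onAxis (d (x + dir k)) e) e ?_ ?_ ?_ ?_ ?_ ?_ <;> intro hk
    · exact absurd hk (by simp [onAxis])
    · exact fin _ _ 1 (.inl ⟨rfl, a1⟩)
    · exact fin _ _ 2 (.inr (.inl ⟨rfl, a2⟩))
    · exact absurd hk (by generalize e = e; revert e; decide)
    · exact fin _ _ 4 (.inr (.inr (.inl ⟨rfl, a4⟩)))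
    · exact fin _ _ 5 (.inr (.inr (.inr ⟨rfl, a5⟩)))

/-- Where there is no fault, the two neighbours on the axis of a cell that is no hub are hubs. -/
lemma ValidOn.hub_next (h : ValidOn Set.univ d) (hf : ∀ x, ¬ Fault d x) {x : ℤ × ℤ}
    (hx : ¬ Hub d x) {k : ZMod 6} (hk : onAxis (d x) k) : Hub d (x + dir k) := by
  have hx' := (h.hub_or (hf x)).resolve_left hx
  refine (h.hub_or (hf (x + dir k))).resolve_right fun hr => ?_
  have h3 := hr (k + 3)
  rw [add_dir_add_three] at h3
  have h2 := hr (k + 2)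
  rw [add_dir_add_two] at h2
  have h1 := hx' (k + 1)
  have keyr : ∀ a r k : ZMod 6, onAxis a k →
    (¬ onAxis r (k + 3) → ¬ onAxis a (k + 3) ∧ ¬ onAxis a r) → ¬ onAxis r (k + 2) := by decide
  have keyu : ∀ a u k : ZMod 6, onAxis a k →
    (¬ onAxis a (k + 1) → ¬ onAxis u (k + 1) ∧ ¬ onAxis u a) → onAxis u (k + 2) := by decide
  exact (h2 (keyr _ _ _ hk h3)).1 (keyu _ _ _ hk h1)

lemma Hub.not_hub_add_dir {x : ℤ × ℤ} (hx : Hub d x) (k : ZMod 6) : ¬ Hub d (x + dir k) := by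
  intro hy
  have h2 := hy (k + 2)
  rw [add_dir_add_two] at h2
  have key : ∀ u k : ZMod 6, onAxis u (k + 1) → ¬ onAxis u (k + 2) := by decide
  exact key _ _ (hx (k + 1)) h2

lemma ValidOn.hub_add_dir_add_dir (h : ValidOn Set.univ d) (hf : ∀ x, ¬ Fault d x) {x : ℤ × ℤ}
    (hx : Hub d x) (k : ZMod 6) : Hub d (x + dir k + dir k) :=
  h.hub_next hf (hx.not_hub_add_dir k) (hx k)

lemma ValidOn.hub_add_nsmul (h : ValidOn Set.univ d) (hf : ∀ x, ¬ Fault d x) {x : ℤ × ℤ}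
    (hx : Hub d x) (k : ZMod 6) (n : ℕ) : Hub d (x + n • (dir k + dir k)) := by
  induction n with
  | zero => simpa using hx
  | succ n ih =>
    rw [succ_nsmul, ← add_assoc, ← add_assoc]
    exact h.hub_add_dir_add_dir hf ih k

lemma ValidOn.hub_add_double (h : ValidOn Set.univ d) (hf : ∀ x, ¬ Fault d x) {x : ℤ × ℤ}
    (hx : Hub d x) (q : ℤ × ℤ) : Hub d (x + (q + q)) := by
  have aux : ∀ (k : ZMod 6) (n : ℤ) {y : ℤ × ℤ}, Hub d y → Hub d (y + n • (dir k + dir k)) := by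
    intro k n y hy
    obtain ⟨m, rfl | rfl⟩ := n.eq_nat_or_neg
    · simpa using h.hub_add_nsmul hf hy k m
    · have := h.hub_add_nsmul hf hy (k + 3) m
      rw [dir_add_three] at this
      convert this using 2
      simp only [neg_smul, natCast_zsmul, smul_add, smul_neg]
  have := aux 1 q.2 (aux 0 q.1 hx)
  convert this using 1
  ext <;> simp <;> ring

/-- Modulo doubles, a lattice cell is `0` or one of three neighbours of `0`, one for each axis. -/
lemma exists_eq_double_or (p : ℤ × ℤ) :
    ∃ q, p = q + q ∨ ∃ k ∈ [(0 : ZMod 6), 1, 2], p = q + q + dir k := by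
  obtain ⟨a, b⟩ := p
  rcases Int.even_or_odd' a with ⟨i, rfl | rfl⟩ <;> rcases Int.even_or_odd' b with ⟨j, rfl | rfl⟩
  · exact ⟨(i, j), .inl (by ext <;> simp <;> ring)⟩
  · exact ⟨(i, j), .inr ⟨1, by decide, by ext <;> simp <;> ring⟩⟩
  · exact ⟨(i, j), .inr ⟨0, by decide, by ext <;> simp <;> ring⟩⟩
  · exact ⟨(i + 1, j), .inr ⟨2, by decide, by ext <;> simp <;> ring⟩⟩

/-! ### Patterns above a ray of a single colour -/

/-- The part of height `h` of a sector of 60 degrees. -/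
def strip (h : ℤ) : Set (ℤ × ℤ) := {x | 0 ≤ x.1 ∧ 0 ≤ x.2 ∧ x.2 ≤ h}

/-- A valid pattern on a strip whose bottom row points along that row. -/
structure AboveRay (h : ℤ) (d : ℤ × ℤ → ZMod 6) : Prop where
  valid : ValidOn (strip h) d
  ray : ∀ a, 0 ≤ a → onAxis (d (a, 0)) 0

/-- From some cell on, all cells of row `r` point along the row. -/
def EventuallyAxial (d : ℤ × ℤ → ZMod 6) (r : ℤ) : Prop := ∃ A, ∀ a, A ≤ a → onAxis (d (a, r)) 0

/-- The sublattice of the cells `(ε + 2 i, 2 j)` consists of hubs. -/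
def HubsFrom (h ε : ℤ) (d : ℤ × ℤ → ZMod 6) : Prop :=
  ∀ i j : ℕ, (2 * j ≤ h → onAxis (d (ε + 2 * i + 1, 2 * j)) 0) ∧
    (2 * j + 1 ≤ h → onAxis (d (ε + 2 * i, 2 * j + 1)) 1 ∧
      onAxis (d (ε + 2 * i + 1, 2 * j + 1)) 2)

lemma AboveRay.mono {h h' : ℤ} (hd : AboveRay h d) (hh : h' ≤ h) : AboveRay h' d :=
  ⟨hd.valid.mono fun _ hx => ⟨hx.1, hx.2.1, hx.2.2.trans hh⟩, hd.ray⟩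

lemma onAxis_one_or_two {a : ZMod 6} (h : ¬ onAxis a 0) : onAxis a 1 ∨ onAxis a 2 := by
  revert a; decide

section strip

variable {h : ℤ}

lemma ValidOn.not_axial_above (hd : ValidOn (strip h) d) {a b : ℤ} (ha : 0 ≤ a) (hb : 0 ≤ b)
    (hb' : b + 1 ≤ h) (hz : onAxis (d (a, b)) 0) : ¬ onAxis (d (a, b + 1)) 0 := by
  have := hd.onAxis_of_same (x := (a, b)) (k := 1) ⟨ha, hb, by simp; omega⟩
    ⟨by simpa [dir] using ha, by simp; omega, by simpa [dir] using hb'⟩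
  revert this
  simp only [dir_one, Prod.mk_add_mk, add_zero]
  revert hz
  generalize d (a, b) = x
  generalize d (a, b + 1) = y
  revert x y; decide

lemma ValidOn.not_axial_above_left (hd : ValidOn (strip h) d) {a b : ℤ} (ha : 0 ≤ a) (hb : 0 ≤ b)
    (hb' : b + 1 ≤ h) (hz : onAxis (d (a + 1, b)) 0) : ¬ onAxis (d (a, b + 1)) 0 := by
  have := hd.onAxis_of_same (x := (a + 1, b)) (k := 2) ⟨by simp; omega, hb, by simp; omega⟩
    ⟨by simp; omega, by simp; omega, by simpa [dir] using hb'⟩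
  revert this
  simp only [dir_two, Prod.mk_add_mk, add_neg_cancel_right]
  revert hz
  generalize d (a + 1, b) = x
  generalize d (a, b + 1) = y
  revert x y; decide

lemma ValidOn.not_same_right (hd : ValidOn (strip h) d) {a b : ℤ} (ha : 0 ≤ a) (hb : 0 ≤ b)
    (hb' : b ≤ h) (hz : ¬ onAxis (d (a, b)) 0) : ¬ onAxis (d (a, b)) (d (a + 1, b)) := by
  have := hd.onAxis_of_same (x := (a, b)) (k := 0) ⟨ha, hb, hb'⟩
    ⟨by simp; omega, by simpa [dir] using hb, by simpa [dir] using hb'⟩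
  revert this
  simp only [dir_zero, Prod.mk_add_mk, add_zero]
  exact fun h1 h2 => hz (h1 h2)

/-- In a row without cells that point along the row, the other two colours alternate. -/
lemma ValidOn.alternate (hd : ValidOn (strip h) d) {A b : ℤ} (hA : 0 ≤ A) (hb : 0 ≤ b)
    (hb' : b ≤ h) (hz : ∀ a, A ≤ a → ¬ onAxis (d (a, b)) 0) {c c' : ZMod 6}
    (hc : c = 1 ∧ c' = 2 ∨ c = 2 ∧ c' = 1) (h0 : onAxis (d (A, b)) c) (i : ℕ) :
    onAxis (d (A + 2 * i, b)) c ∧ onAxis (d (A + 2 * i + 1, b)) c' := by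
  have key : ∀ x y c c' : ZMod 6, (c = 1 ∧ c' = 2 ∨ c = 2 ∧ c' = 1) → onAxis x c →
    ¬ onAxis y 0 → ¬ onAxis x y → onAxis y c' := by decide
  have step : ∀ a, A ≤ a → ∀ c c', (c = 1 ∧ c' = 2 ∨ c = 2 ∧ c' = 1) → onAxis (d (a, b)) c →
      onAxis (d (a + 1, b)) c' := fun a ha c c' hcc hx =>
    key _ _ _ _ hcc hx (hz _ (by omega)) (hd.not_same_right (by omega) hb hb' (hz a ha))
  have hc2 : c' = 1 ∧ c = 2 ∨ c' = 2 ∧ c = 1 := by tauto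
  induction i with
  | zero =>
    have := step A le_rfl c c' hc h0
    simpa using ⟨h0, this⟩
  | succ i ih =>
    have h1 := step (A + 2 * i + 1) (by omega) c' c hc2 ih.2
    have h2 := step _ (by omega) c c' hc h1
    push_cast
    rw [show A + 2 * ((i : ℤ) + 1) = A + 2 * i + 1 + 1 by ring]
    exact ⟨h1, h2⟩

/-- If row `r` alternates in the wrong phase, so that its cells of colour `0` are
faults, then it is eventually axial: each of these cells continues its arrow, to the right or to the
left. -/
lemma ValidOn.eventuallyAxial_of_faults (hd : ValidOn (strip h) d) {r ε : ℤ} (hr : 1 ≤ r)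
    (hrh : r + 1 ≤ h) (hε : 0 ≤ ε) (hz : ∀ i : ℕ, onAxis (d (ε + 2 * i + 1, r)) 0)
    (hup : ∀ i : ℕ, onAxis (d (ε + 2 * i, r + 1)) 2 ∧ onAxis (d (ε + 2 * i + 1, r + 1)) 1)
    (hlo : ∀ i : ℕ, onAxis (d (ε + 2 * i, r - 1)) 1 ∧ onAxis (d (ε + 2 * i + 1, r - 1)) 2) :
    EventuallyAxial d r := by
  have key0 : ∀ x : ZMod 6, onAxis x 0 → x = 0 ∨ x = 3 := by decide
  have keys : ∀ c x y : ZMod 6, onAxis x c → onAxis y c → onAxis x y := by decide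
  have right : ∀ i : ℕ, d (ε + 2 * i + 1, r) = 0 → d (ε + 2 * i + 2, r) = 0 := by
    intro i hi
    have := hd.arrow_continues (x := (ε + 2 * i + 1, r)) ⟨by simp; omega, by simp; omega,
      by simp; omega⟩
    rw [hi] at this
    simp only [strip, Prod.mk_add_mk, dir_zero, dir_one, dir_five, zero_add, Set.mem_ofPred_eq,
      add_zero] at this
    rw [show ε + 2 * (i : ℤ) + 1 + 1 = ε + 2 * i + 2 by ring] at this
    refine this (by omega) (by omega) (by omega) ?_
    refine keys 1 _ _ (hup i).2 ?_
    have := (hlo (i + 1)).1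
    rwa [show (ε + 2 * ((i + 1 : ℕ) : ℤ), r - 1) = (ε + 2 * (i : ℤ) + 2, r + -1) by
      push_cast; ext <;> simp only <;> ring] at this
  have left : ∀ i : ℕ, d (ε + 2 * i + 1, r) = 3 → d (ε + 2 * i, r) = 3 := by
    intro i hi
    have := hd.arrow_continues (x := (ε + 2 * i + 1, r)) ⟨by simp; omega, by simp; omega,
      by simp; omega⟩
    rw [hi] at this
    rw [show (3 : ZMod 6) + 1 = 4 by decide, show (3 : ZMod 6) + 5 = 2 by decide] at this
    simp only [strip, Prod.mk_add_mk, dir_two, dir_three, dir_four, Set.mem_ofPred_eq] at this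
    rw [show ε + 2 * (i : ℤ) + 1 + -1 = ε + 2 * i by ring, add_zero, add_zero] at this
    refine this (by omega) (by omega) (by omega) ?_
    refine keys 2 _ _ (hlo i).2 (hup i).1
  by_cases hex : ∃ i : ℕ, d (ε + 2 * i + 1, r) = 0
  · obtain ⟨i, hi⟩ := hex
    have all : ∀ j : ℕ, i ≤ j → d (ε + 2 * j + 1, r) = 0 := by
      intro j hj
      induction j, hj using Nat.le_induction with
      | base => exact hi
      | succ j hj ih =>
        have h1 := right j ih
        have hm := hd.matched (ε + 2 * j + 2, r) ⟨by simp; omega, by simp; omega, by simp; omega⟩ 0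
          ⟨by simp; omega, by simp; omega, by simp; omega⟩
        have hz' := hz (j + 1)
        rw [h1] at hm
        simp only [dir_zero, Prod.mk_add_mk, add_zero] at hm
        push_cast at hz' ⊢
        rw [show ε + 2 * ((j : ℤ) + 1) + 1 = ε + 2 * j + 2 + 1 by ring] at hz' ⊢
        revert hm hz'
        generalize d (ε + 2 * j + 2 + 1, r) = y
        revert y; decide
    refine ⟨ε + 2 * i + 1, fun a ha => ?_⟩
    rcases Int.even_or_odd' (a - ε) with ⟨j, hj | hj⟩
    · have := right (j - 1).toNat (all _ (by omega))
      rw [show ε + 2 * ((j - 1).toNat : ℤ) + 2 = a by omega] at this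
      rw [this]; decide
    · have := all j.toNat (by omega)
      rw [show ε + 2 * (j.toNat : ℤ) + 1 = a by omega] at this
      rw [this]; decide
  · push Not at hex
    refine ⟨ε, fun a ha => ?_⟩
    rcases Int.even_or_odd' (a - ε) with ⟨j, hj | hj⟩
    · have := left j.toNat ((key0 _ (hz _)).resolve_left (hex _))
      rw [show ε + 2 * (j.toNat : ℤ) = a by omega] at this
      rw [this]; decide
    · have := hz j.toNat
      rwa [show ε + 2 * (j.toNat : ℤ) + 1 = a by omega] at this

/-- Above an axial ray the hubs form a sublattice, as long as no further row is axial. -/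
lemma AboveRay.hubsFrom (hd : AboveRay h d) {ε : ℤ} (hε : 0 ≤ ε)
    (h1 : 1 ≤ h → onAxis (d (ε, 1)) 1)
    (hne : ∀ r, 1 ≤ r → r < h → ¬ EventuallyAxial d r) : HubsFrom h ε d := by
  intro i j
  induction j generalizing i with
  | zero =>
    refine ⟨fun _ => hd.ray _ (by omega), fun hh => ?_⟩
    simp only [Nat.cast_zero, mul_zero, zero_add] at hh ⊢
    refine hd.valid.alternate hε zero_le_one hh (fun a ha => ?_) (by decide) (h1 hh) i
    exact hd.valid.not_axial_above (by omega) le_rfl (by simpa using hh) (hd.ray a (by omega))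
  | succ j ih =>
    have hz : 2 * ((j : ℤ) + 1) ≤ h → ∀ i : ℕ, onAxis (d (ε + 2 * i + 1, 2 * (j + 1))) 0 := by
      intro hh i
      have u := ((ih i).2 (by omega)).2
      have v := ((ih (i + 1)).2 (by omega)).1
      have e1 := hd.valid.onAxis_of_same (x := (ε + 2 * i + 1, 2 * j + 1)) (k := 1)
        ⟨by simp; omega, by simp; omega, by simp; omega⟩
        ⟨by simp; omega, by simp; omega, by simp; omega⟩
      have e2 := hd.valid.onAxis_of_same (x := (ε + 2 * i + 2, 2 * j + 1)) (k := 2)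
        ⟨by simp; omega, by simp; omega, by simp; omega⟩
        ⟨by simp; omega, by simp; omega, by simp; omega⟩
      simp only [dir_one, dir_two, Prod.mk_add_mk] at e1 e2
      push_cast at v
      rw [show ε + 2 * ((i : ℤ) + 1) = ε + 2 * i + 2 by ring] at v
      rw [show ε + 2 * (i : ℤ) + 1 + 0 = ε + 2 * i + 1 by ring,
        show 2 * (j : ℤ) + 1 + 1 = 2 * (j + 1) by ring] at e1
      rw [show ε + 2 * (i : ℤ) + 2 + -1 = ε + 2 * i + 1 by ring,
        show 2 * (j : ℤ) + 1 + 1 = 2 * (j + 1) by ring] at e2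
      have key : ∀ u v z : ZMod 6, onAxis u 2 → onAxis v 1 → (onAxis u z → onAxis u 1) →
        (onAxis v z → onAxis v 2) → onAxis z 0 := by decide
      exact key _ _ _ u v e1 e2
    push_cast
    refine ⟨fun hh => hz hh i, fun hh => ?_⟩
    have hz' := hz (by omega)
    have hn : ∀ a, ε ≤ a → ¬ onAxis (d (a, 2 * (j + 1) + 1)) 0 := by
      intro a ha
      rcases Int.even_or_odd' (a - ε) with ⟨l, hl | hl⟩
      · refine hd.valid.not_axial_above_left (by omega) (by omega) hh ?_
        have := hz' l.toNat
        rwa [show ε + 2 * (l.toNat : ℤ) = a by omega] at this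
      · refine hd.valid.not_axial_above (by omega) (by omega) hh ?_
        have := hz' l.toNat
        rwa [show ε + 2 * (l.toNat : ℤ) + 1 = a by omega] at this
    rcases onAxis_one_or_two (hn ε le_rfl) with h0 | h0
    · exact hd.valid.alternate hε (by omega) hh hn (by decide) h0 i
    · refine absurd ?_ (hne (2 * (j + 1)) (by omega) (by omega))
      refine hd.valid.eventuallyAxial_of_faults (by omega) hh hε hz'
        (hd.valid.alternate hε (by omega) hh hn (by decide) h0) fun i => ?_
      rw [show 2 * ((j : ℤ) + 1) - 1 = 2 * j + 1 by ring]
      exact (ih i).2 (by omega)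

lemma AboveRay.exists_phase (hd : AboveRay h d) (hh : 1 ≤ h) :
    ∃ ε, 1 ≤ ε ∧ onAxis (d (ε, 1)) 1 := by
  have hn : ∀ a, 0 ≤ a → ¬ onAxis (d (a, 1)) 0 := fun a ha =>
    hd.valid.not_axial_above ha le_rfl (by simpa using hh) (hd.ray a ha)
  rcases onAxis_one_or_two (hn 1 (by norm_num)) with h1 | h1
  · exact ⟨1, le_rfl, h1⟩
  · have := (hd.valid.alternate zero_le_one zero_le_one hh (fun a ha => hn a (by omega))
      (c' := 1) (by decide) h1 0).2
    exact ⟨2, by norm_num, by simpa using this⟩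

/-- The pattern on the sublattice of hubs is of the same kind, with half the height. -/
lemma AboveRay.half (hd : AboveRay h d) {ε : ℤ} (hε : 1 ≤ ε) (hub : HubsFrom h ε d) {h' : ℤ}
    (hh : 2 * h' ≤ h) : AboveRay h' (d ∘ fun x => (ε + 2 * x.1, 2 * x.2)) := by
  refine ⟨hd.valid.comp _ ?_ ?_ ?_, fun a ha => ?_⟩
  · intro x k
    ext <;> simp <;> ring
  · rintro ⟨a, b⟩ ⟨h1, h2, h3⟩
    simp only at h1 h2 h3
    exact ⟨by simp only; omega, by simp only; omega, by simp only; omega⟩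
  · rintro ⟨a, b⟩ ⟨h1, h2, h3⟩ k ⟨k1, k2, k3⟩
    simp only at h1 h2 h3
    have hk : k = 0 ∨ k = 1 ∨ k = 2 ∨ k = 3 ∨ k = 4 ∨ k = 5 := by
      clear k1 k2 k3; revert k; decide
    have get := fun (i j : ℤ) (hi : 0 ≤ i) (hj : 0 ≤ j) => by
      have := hub i.toNat j.toNat
      rw [Int.toNat_of_nonneg hi, Int.toNat_of_nonneg hj] at this
      exact this
    have fix : ∀ {x y : ℤ × ℤ} {c c' : ZMod 6}, onAxis (d x) c → x = y →
        (onAxis (d x) c → onAxis (d x) c') → onAxis (d y) c' := by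
      rintro x y c c' h1 rfl h2; exact h2 h1
    have ax : ∀ x k : ZMod 6, onAxis x k → onAxis x (k + 3) := by decide
    rcases hk with rfl | rfl | rfl | rfl | rfl | rfl <;>
      simp only [dir_zero, dir_one, dir_two, dir_three, dir_four, dir_five,
        Prod.mk_add_mk] at k1 k2 k3 ⊢ <;>
      refine ⟨⟨by simp only; omega, by simp only; omega, by simp only; omega⟩, ?_⟩
    · exact fix ((get a b h1 h2).1 (by omega)) (by ext <;> simp) id
    · exact fix ((get a b h1 h2).2 (by omega)).1 (by ext <;> simp) id
    · exact fix ((get (a - 1) b (by omega) h2).2 (by omega)).2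
        (by ext <;> simp only <;> ring) id
    · exact fix ((get (a - 1) b (by omega) h2).1 (by omega))
        (by ext <;> simp only <;> ring) (ax _ _)
    · exact fix ((get a (b - 1) h1 (by omega)).2 (by omega)).1
        (by ext <;> simp only <;> ring) (ax _ _)
    · exact fix ((get a (b - 1) h1 (by omega)).2 (by omega)).2
        (by ext <;> simp only <;> ring) (ax _ _)
  · exact hd.ray _ (by simp only; omega)

end strip

/-- No second row above an axial ray is eventually axial. -/
theorem AboveRay.not_eventuallyAxial {r : ℕ} (hr : 1 ≤ r) (hd : AboveRay r d) :
    ¬ EventuallyAxial d r := by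
  induction r using Nat.strong_induction_on generalizing d with
  | _ r ih =>
    rintro ⟨A, hA⟩
    obtain ⟨ε, hε, h1⟩ := hd.exists_phase (by exact_mod_cast hr)
    have hub : HubsFrom r ε d := hd.hubsFrom (by omega) (fun _ => h1) fun s hs hsr => by
      have := ih s.toNat (by omega) (by omega) (hd.mono (by omega))
      rwa [Int.toNat_of_nonneg (by omega)] at this
    rcases Nat.even_or_odd' r with ⟨s, rfl | rfl⟩
    · refine ih s (by omega) (by omega) (hd.half hε hub (by push_cast; omega)) ⟨A.toNat, ?_⟩
      intro a ha
      have := hA (ε + 2 * a) (by omega)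
      push_cast at this
      exact this
    · have h2 := hA (ε + 2 * A.toNat) (by omega)
      push_cast at h2
      have h3 := ((hub A.toNat s).2 (by push_cast; omega)).1
      revert h2 h3
      generalize d _ = x
      revert x; decide

/-- A pattern above an axial ray has no period along the ray. -/
theorem AboveRay.not_periodic {m : ℕ} (hm : 0 < m) (hd : ∀ h, AboveRay h d) :
    ¬ ∀ a b : ℤ, d (a + m, b) = d (a, b) := by
  induction m using Nat.strong_induction_on generalizing d with
  | _ m ih =>
    intro hp
    obtain ⟨ε, hε, h1⟩ := (hd 1).exists_phase le_rfl
    have hub : ∀ h, HubsFrom h ε d := fun h => (hd h).hubsFrom (by omega) (fun _ => h1)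
      fun s hs _ => by
        have := (hd s.toNat).not_eventuallyAxial (by omega)
        rwa [Int.toNat_of_nonneg (by omega)] at this
    rcases Nat.even_or_odd' m with ⟨s, rfl | rfl⟩
    · refine ih s (by omega) (by omega) (fun h => (hd _).half hε (hub _) le_rfl) fun a b => ?_
      have := hp (ε + 2 * a) (2 * b)
      simp only [Function.comp_apply]
      rw [← this]
      congr 2
      push_cast
      ring
    · have h2 := ((hub 1 s 0).2 (by norm_num)).2
      have h3 := hp ε 1
      simp only [Nat.cast_zero, mul_zero, zero_add] at h2
      push_cast at h3
      rw [show ε + (2 * (s : ℤ) + 1) = ε + 2 * s + 1 by ring] at h3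
      rw [h3] at h2
      revert h1 h2
      generalize d _ = x
      revert x; decide

/-! ### No valid pattern has a period -/

/-- The linear map of the hexagonal lattice that rotates by `e` times 60 degrees. -/
def rot (e : ZMod 6) (x : ℤ × ℤ) : ℤ × ℤ := x.1 • dir e + x.2 • dir (e + 1)

lemma rot_add (e : ZMod 6) (x y : ℤ × ℤ) : rot e (x + y) = rot e x + rot e y := by
  simp only [rot, Prod.fst_add, Prod.snd_add, add_smul]; abel

lemma rot_neg (e : ZMod 6) (x : ℤ × ℤ) : rot e (-x) = -rot e x := by
  simp only [rot, Prod.fst_neg, Prod.snd_neg, neg_smul]; abel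

lemma rot_dir (e k : ZMod 6) : rot e (dir k) = dir (e + k) := by revert e k; decide

lemma rot_rot_neg (e : ZMod 6) (x : ℤ × ℤ) : rot e (rot (-e) x) = x := by
  have h1 : rot e (rot (-e) (dir 0)) = dir 0 := by rw [rot_dir, rot_dir]; congr 1; abel
  have h2 : rot e (rot (-e) (dir 1)) = dir 1 := by rw [rot_dir, rot_dir]; congr 1; abel
  have hx : x = x.1 • dir 0 + x.2 • dir 1 := by ext <;> simp
  have hs : ∀ (e : ZMod 6) (n : ℤ) (y), rot e (n • y) = n • rot e y := by
    intro e n y; simp only [rot, Prod.smul_fst, Prod.smul_snd, smul_add, smul_smul, smul_eq_mul]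
  conv_rhs => rw [hx]
  conv_lhs => rw [hx]
  rw [rot_add, hs, hs, rot_add, hs, hs, h1, h2]

lemma ValidOn.rotate (h : ValidOn Set.univ d) (x : ℤ × ℤ) (e : ZMod 6) :
    ValidOn Set.univ fun y => d (x + rot e y) - e := by
  refine ⟨fun y _ k _ => ?_, fun y hy => ?_⟩
  · have hm := h.matched (x + rot e y) trivial (e + k) trivial
    simp only [rot_add, rot_dir, ← add_assoc]
    have key : ∀ a k e : ZMod 6, isOut (a - e) k = isOut a (e + k) := by decide
    rw [key, key, ← add_assoc]
    exact hm
  · refine h.acyclic (x + rot e y) (TransGen.lift (fun y => x + rot e y) (fun a b hab => ?_) _ _ hy)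
    refine ⟨trivial, trivial, ?_⟩
    simp only [hab.2.2, rot_add, rot_dir, add_assoc, add_sub_cancel]

/-- An arrow at a fault starts an infinite straight ray of arrows. -/
lemma ValidOn.ray_of_fault (h : ValidOn Set.univ d) (h0 : d 0 = 0) (hf : Fault d 0) (n : ℕ) :
    d ((n : ℤ), 0) = 0 ∧ Fault d ((n : ℤ), 0) := by
  induction n with
  | zero => exact ⟨h0, hf⟩
  | succ n ih =>
    obtain ⟨hn, hfn⟩ := ih
    have hc := h.arrow_continues (x := ((n : ℤ), 0)) trivial trivial trivial trivial hfn
    have e0 : ((n : ℤ), (0 : ℤ)) + dir 0 = (((n + 1 : ℕ) : ℤ), 0) := by simp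
    rw [hn, e0] at hc
    refine ⟨hc, ?_⟩
    unfold Fault at hfn ⊢
    rw [hn] at hfn
    rw [hc]
    simp only [zero_add] at hfn ⊢
    have a1 : ((n : ℤ), (0 : ℤ)) + dir 1 + dir 0 = (((n + 1 : ℕ) : ℤ), 0) + dir 1 := by
      simp
    have a5 : ((n : ℤ), (0 : ℤ)) + dir 5 + dir 0 = (((n + 1 : ℕ) : ℤ), 0) + dir 5 := by
      simp
    have c1 := h.onAxis_of_same (x := ((n : ℤ), 0) + dir 1) (k := 0) trivial trivial
    have c5 := h.onAxis_of_same (x := ((n : ℤ), 0) + dir 5) (k := 0) trivial trivial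
    rw [a1] at c1
    rw [a5] at c5
    have b1 := h.onAxis_of_same (x := ((n : ℤ), 0)) (k := 1) trivial trivial
    have b5 := h.onAxis_of_same (x := ((n : ℤ), 0)) (k := 5) trivial trivial
    have b1' := h.onAxis_of_same (x := (((n + 1 : ℕ) : ℤ), 0)) (k := 1) trivial trivial
    have b5' := h.onAxis_of_same (x := (((n + 1 : ℕ) : ℤ), 0)) (k := 5) trivial trivial
    rw [hn] at b1 b5
    rw [hc] at b1' b5'
    have key : ∀ u l u' l' : ZMod 6, onAxis u l → (onAxis 0 u → onAxis 0 1) →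
      (onAxis 0 l → onAxis 0 5) → (onAxis 0 u' → onAxis 0 1) → (onAxis 0 l' → onAxis 0 5) →
      (onAxis u u' → onAxis u 0) → (onAxis l l' → onAxis l 0) → onAxis u' l' := by decide
    exact key _ _ _ _ hfn b1 b5 b1' b5' c1 c5

/-- A pattern with a fault has no period: neither along the ray that starts at the fault, nor in
another direction, as this would give a second ray parallel to the first. -/
theorem ValidOn.not_periodic_of_fault (h : ValidOn Set.univ d) {x : ℤ × ℤ} (hf : Fault d x)
    {p : ℤ × ℤ} (hp : p ≠ 0) : ¬ ∀ y, d (y + p) = d y := by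
  intro hper
  set e := d x with he
  set D : ℤ × ℤ → ZMod 6 := fun y => d (x + rot e y) - e with hD
  have hv : ValidOn Set.univ D := h.rotate x e
  have hrot0 : rot e 0 = 0 := by simp [rot]
  have hD0 : D 0 = 0 := by change d (x + rot e 0) - e = 0; rw [hrot0, add_zero, sub_self]
  have hDf : Fault D 0 := by
    unfold Fault at hf ⊢
    rw [hD0]
    simp only [hD, zero_add, rot_dir]
    have key : ∀ a b e : ZMod 6, onAxis a b → onAxis (a - e) (b - e) := by decide
    exact key _ _ _ hf
  have hray : ∀ h, AboveRay h D := fun h => ⟨hv.mono (Set.subset_univ _), fun a ha => by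
    have := (hv.ray_of_fault hD0 hDf a.toNat).1
    rw [Int.toNat_of_nonneg ha] at this
    rw [this]; decide⟩
  have hperD : ∀ q, (∀ y, d (y + rot e q) = d y) → ∀ y, D (y + q) = D y := by
    intro q hq y
    simp only [hD, rot_add, ← add_assoc, hq]
  have hneg : ∀ y, d (y + -p) = d y := by
    intro y; rw [← hper (y + -p)]; simp
  obtain ⟨q, hq0, hq, hsgn⟩ : ∃ q : ℤ × ℤ, q ≠ 0 ∧ (∀ y, D (y + q) = D y) ∧
      (0 < q.2 ∨ q.2 = 0 ∧ 0 < q.1) := by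
    have hp' := rot_rot_neg e p
    set q := rot (-e) p with hqdef
    have hq0 : q ≠ 0 := by
      intro h0; rw [h0, hrot0] at hp'; exact hp hp'.symm
    have h1 : ∀ y, D (y + q) = D y := hperD q (by rwa [hp'])
    have h2 : ∀ y, D (y + -q) = D y := hperD (-q) (by rwa [rot_neg, hp'])
    have : q.1 ≠ 0 ∨ q.2 ≠ 0 := by
      by_contra hc; push Not at hc; exact hq0 (Prod.ext hc.1 hc.2)
    by_cases hs : 0 < q.2 ∨ q.2 = 0 ∧ 0 < q.1
    · exact ⟨q, hq0, h1, hs⟩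
    · exact ⟨-q, by simpa using hq0, h2, by simp only [Prod.snd_neg, Prod.fst_neg]; omega⟩
  rcases hsgn with h2 | ⟨h2, h1⟩
  · have := (hray (q.2.toNat)).not_eventuallyAxial (by omega)
    rw [Int.toNat_of_nonneg h2.le] at this
    refine this ⟨max q.1 0, fun a ha => ?_⟩
    have := hq (a - q.1, 0)
    rw [show (a - q.1, (0 : ℤ)) + q = (a, q.2) by ext <;> simp] at this
    rw [this]
    exact (hray 0).ray _ (by omega)
  · refine AboveRay.not_periodic (m := q.1.toNat) (by omega) hray fun a b => ?_
    have := hq (a, b)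
    rwa [show (a, b) + q = (a + (q.1.toNat : ℤ), b) by ext <;> simp <;> omega] at this

/-- A valid pattern on the whole lattice has no period. Without faults, a period is even and gives a
shorter one on the sublattice of hubs. -/
theorem ValidOn.period_eq_zero (h : ValidOn Set.univ d) {p : ℤ × ℤ}
    (hper : ∀ y, d (y + p) = d y) : p = 0 := by
  obtain ⟨n, hn⟩ : ∃ n, p.1.natAbs + p.2.natAbs = n := ⟨_, rfl⟩
  induction n using Nat.strong_induction_on generalizing d p with
  | _ n ih =>
    by_contra hp
    by_cases hf : ∃ x, Fault d x
    · obtain ⟨x, hx⟩ := hf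
      exact h.not_periodic_of_fault hx hp hper
    push Not at hf
    obtain ⟨x, hx⟩ : ∃ x, Hub d x := by
      by_cases h0 : Hub d 0
      · exact ⟨0, h0⟩
      · exact ⟨_, h.hub_next hf h0 (k := d 0) (by simp [onAxis])⟩
    obtain ⟨q, rfl | ⟨k, -, rfl⟩⟩ := exists_eq_double_or p
    · have hhub := h.hub_add_double hf hx
      have hv : ValidOn Set.univ (d ∘ fun y => x + (y + y)) := by
        refine h.comp _ (fun y k => by abel) (fun _ _ => trivial) fun y _ k _ => ⟨trivial, ?_⟩
        exact hhub y k
      have hq0 : q ≠ 0 := by rintro rfl; simp at hp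
      refine hq0 (ih _ ?_ hv (p := q) (fun y => ?_) rfl)
      · have : q.1 ≠ 0 ∨ q.2 ≠ 0 := by
          by_contra hc; push Not at hc; exact hq0 (Prod.ext hc.1 hc.2)
        simp only [Prod.fst_add, Prod.snd_add] at hn
        omega
      · simp only [Function.comp_apply]
        rw [← hper (x + (y + y))]
        congr 1; abel
    · refine (h.hub_add_double hf hx q).not_hub_add_dir k fun j => ?_
      have := hx j
      rw [← hper] at this
      convert this using 2
      congr 1; abel

end pattern

/-! ### Coordinates of the triangular grid -/

/-- First coordinate with respect to the basis `1, ω`. -/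
def ca : ℂ →L[ℝ] ℝ := Complex.reCLM - (1 / Real.sqrt 3) • Complex.imCLM

/-- Second coordinate with respect to the basis `1, ω`. -/
def cb : ℂ →L[ℝ] ℝ := (2 / Real.sqrt 3) • Complex.imCLM

lemma sqrt_three_ne_zero : Real.sqrt 3 ≠ 0 := by positivity

lemma sqrt_three_mul_self : Real.sqrt 3 * Real.sqrt 3 = 3 := Real.mul_self_sqrt (by norm_num)

lemma ca_apply (z : ℂ) : ca z = z.re - z.im / Real.sqrt 3 := by
  simp [ca]; ring

lemma cb_apply (z : ℂ) : cb z = 2 * z.im / Real.sqrt 3 := by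
  simp [cb]; ring

@[simp] lemma ca_one : ca 1 = 1 := by simp [ca_apply]
@[simp] lemma cb_one : cb 1 = 0 := by simp [cb_apply]
@[simp] lemma ca_omega : ca omega = 0 := by
  have := sqrt_three_ne_zero
  simp only [ca_apply, omega]; field_simp; norm_num
@[simp] lemma cb_omega : cb omega = 1 := by
  have := sqrt_three_ne_zero
  simp only [cb_apply, omega]; field_simp
@[simp] lemma ca_real_mul (t : ℝ) (z : ℂ) : ca (t * z) = t * ca z := by
  have := ca.map_smul t z
  simpa using this
@[simp] lemma cb_real_mul (t : ℝ) (z : ℂ) : cb (t * z) = t * cb z := by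
  have := cb.map_smul t z
  simpa using this
@[simp] lemma ca_ofReal (t : ℝ) : ca (t : ℂ) = t := by simp [ca_apply]
@[simp] lemma cb_ofReal (t : ℝ) : cb (t : ℂ) = 0 := by simp [cb_apply]
@[simp] lemma ca_intCast (t : ℤ) : ca (t : ℂ) = t := by simp [ca_apply]
@[simp] lemma cb_intCast (t : ℤ) : cb (t : ℂ) = 0 := by simp [cb_apply]

@[simp] lemma ca_gridPoint (m n : ℤ) : ca (gridPoint m n) = m := by
  have := ca_real_mul n omega
  simp only [Complex.ofReal_intCast] at this
  simp [gridPoint, this]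

@[simp] lemma cb_gridPoint (m n : ℤ) : cb (gridPoint m n) = n := by
  have := cb_real_mul n omega
  simp only [Complex.ofReal_intCast] at this
  simp [gridPoint, this]

lemma eq_ca_add_cb (z : ℂ) : z = (ca z : ℂ) + (cb z : ℂ) * omega := by
  have := sqrt_three_ne_zero
  apply Complex.ext
  · simp only [ca_apply, cb_apply, omega, Complex.add_re, Complex.ofReal_re, Complex.mul_re,
      Complex.ofReal_im, zero_mul, sub_zero]
    field_simp
    ring
  · simp only [ca_apply, cb_apply, omega, Complex.add_im, Complex.ofReal_im, Complex.mul_im,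
      Complex.ofReal_re, zero_mul, add_zero, zero_add]
    field_simp

lemma ext_coord {z w : ℂ} (h1 : ca z = ca w) (h2 : cb z = cb w) : z = w := by
  rw [eq_ca_add_cb z, eq_ca_add_cb w, h1, h2]

lemma omega_sq : omega * omega = omega - 1 := by
  have h := sqrt_three_mul_self
  apply Complex.ext <;> simp [omega] <;> ring_nf
  · rw [Real.sq_sqrt (by norm_num)]; norm_num

lemma omega_pow_three : omega ^ 3 = -1 := by
  linear_combination (omega + 1) * omega_sq

lemma omega_pow_six : omega ^ 6 = 1 := by
  linear_combination (omega ^ 3 - 1) * omega_pow_three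

@[simp] lemma ca_omega_mul (z : ℂ) : ca (omega * z) = -cb z := by
  conv_lhs => rw [eq_ca_add_cb z,
    show omega * (ca z + cb z * omega) = ((ca z + cb z : ℝ) : ℂ) * omega + ((-cb z : ℝ) : ℂ) by
      push_cast; linear_combination (cb z : ℂ) * omega_sq]
  rw [map_add, ca_real_mul, ca_ofReal, ca_omega]
  ring

@[simp] lemma cb_omega_mul (z : ℂ) : cb (omega * z) = ca z + cb z := by
  conv_lhs => rw [eq_ca_add_cb z,
    show omega * (ca z + cb z * omega) = ((ca z + cb z : ℝ) : ℂ) * omega + ((-cb z : ℝ) : ℂ) by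
      push_cast; linear_combination (cb z : ℂ) * omega_sq]
  rw [map_add, cb_real_mul, cb_ofReal, cb_omega]
  ring

lemma norm_sq_eq (z : ℂ) : ‖z‖ ^ 2 = ca z ^ 2 + ca z * cb z + cb z ^ 2 := by
  have := sqrt_three_ne_zero
  have h3 : Real.sqrt 3 ^ 2 = 3 := Real.sq_sqrt (by norm_num)
  rw [← Complex.normSq_eq_norm_sq, Complex.normSq_apply, ca_apply, cb_apply]
  field_simp
  ring_nf
  rw [h3]

lemma norm_omega : ‖omega‖ = 1 := by
  have := norm_sq_eq omega
  simp at this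
  have := norm_nonneg omega
  grind

/-! ### Unit triangles and cells -/

/-- The closed unit triangle with the vertices `s`, `s + r` and `s + r ω`, where `r` has norm
one. -/
def unitTriangle (s r : ℂ) : Set ℂ :=
  {z | ∃ α β : ℝ, 0 ≤ α ∧ 0 ≤ β ∧ α + β ≤ 1 ∧ z = s + r * (α + β * omega)}

lemma convexHull_triple (s u v : ℂ) : convexHull ℝ {s, s + u, s + v} =
    {z | ∃ α β : ℝ, 0 ≤ α ∧ 0 ≤ β ∧ α + β ≤ 1 ∧ z = s + α * u + β * v} := by
  apply Set.Subset.antisymm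
  · apply convexHull_min
    · rintro z (rfl | rfl | rfl)
      · exact ⟨0, 0, by norm_num, by norm_num, by norm_num, by simp⟩
      · exact ⟨1, 0, by norm_num, by norm_num, by norm_num, by simp⟩
      · exact ⟨0, 1, by norm_num, by norm_num, by norm_num, by simp⟩
    · rintro _ ⟨α, β, h1, h2, h3, rfl⟩ _ ⟨γ, δ, h4, h5, h6, rfl⟩ p q hp hq hpq
      refine ⟨p * α + q * γ, p * β + q * δ, by positivity, by positivity, by nlinarith, ?_⟩
      obtain rfl : q = 1 - p := by linarith
      simp only [Complex.real_smul]
      push_cast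
      ring
  · rintro z ⟨α, β, h1, h2, h3, rfl⟩
    have hs : (convexHull ℝ ({s, s + u, s + v} : Set ℂ)) ⊇ {s, s + u, s + v} :=
      subset_convexHull _ _
    have := (convex_convexHull ℝ ({s, s + u, s + v} : Set ℂ)).sum_mem (t := Finset.univ)
      (w := ![1 - α - β, α, β]) (z := ![s, s + u, s + v])
      (by intro i _; fin_cases i <;> simp <;> linarith)
      (by simp [Fin.sum_univ_three]; ring)
      (by intro i _; fin_cases i <;> apply hs <;> simp)
    convert this using 1
    simp [Fin.sum_univ_three]
    ring

/-- The reference point of a cell: the vertex from which its edges run parallel to `±1`, `±ω`. -/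
def Cell.corner : Cell → ℤ × ℤ
  | .up m n => (m, n)
  | .down m n => (m + 1, n + 1)

/-- Upward triangles are `1`, downward ones are `-1`. -/
def Cell.sign : Cell → ℤ
  | .up _ _ => 1
  | .down _ _ => -1

lemma Cell.triangle_eq (c : Cell) :
    c.triangle = unitTriangle (gridPoint c.corner.1 c.corner.2) c.sign := by
  cases c with
  | up m n =>
    have := convexHull_triple (gridPoint m n) 1 omega
    rw [show gridPoint m n + 1 = gridPoint (m + 1) n by simp only [gridPoint]; push_cast; ring,
      show gridPoint m n + omega = gridPoint m (n + 1) by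
        simp only [gridPoint]; push_cast; ring] at this
    simp only [Cell.triangle, this, unitTriangle, Cell.corner, Cell.sign]
    ext z
    simp only [Set.mem_ofPred_eq]
    refine exists_congr fun α => exists_congr fun β => ?_
    rw [show gridPoint m n + (α : ℂ) * 1 + β * omega
      = gridPoint m n + ((1 : ℤ) : ℂ) * (α + β * omega) by push_cast; ring]
  | down m n =>
    have := convexHull_triple (gridPoint (m + 1) (n + 1)) (-1) (-omega)
    rw [show gridPoint (m + 1) (n + 1) + -1 = gridPoint m (n + 1) by
        simp only [gridPoint]; push_cast; ring,
      show gridPoint (m + 1) (n + 1) + -omega = gridPoint (m + 1) n by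
        simp only [gridPoint]; push_cast; ring] at this
    rw [Cell.triangle, show ({gridPoint (m + 1) n, gridPoint m (n + 1),
      gridPoint (m + 1) (n + 1)} : Set ℂ) = {gridPoint (m + 1) (n + 1), gridPoint m (n + 1),
      gridPoint (m + 1) n} by ext z; simp only [Set.mem_insert_iff, Set.mem_singleton_iff]; tauto,
      this]
    simp only [unitTriangle, Cell.corner, Cell.sign]
    ext z
    simp only [Set.mem_ofPred_eq]
    refine exists_congr fun α => exists_congr fun β => ?_
    rw [show gridPoint (m + 1) (n + 1) + (α : ℂ) * -1 + β * -omega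
      = gridPoint (m + 1) (n + 1) + ((-1 : ℤ) : ℂ) * (α + β * omega) by push_cast; ring]

lemma mem_up {m n : ℤ} {z : ℂ} :
    z ∈ (Cell.up m n).triangle ↔ (m : ℝ) ≤ ca z ∧ (n : ℝ) ≤ cb z ∧ ca z + cb z ≤ m + n + 1 := by
  rw [Cell.triangle_eq]
  simp only [unitTriangle, Cell.corner, Cell.sign, Set.mem_ofPred_eq]
  constructor
  · rintro ⟨α, β, h1, h2, h3, rfl⟩
    simp
    exact ⟨h1, h2, by linarith⟩
  · rintro ⟨h1, h2, h3⟩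
    refine ⟨ca z - m, cb z - n, by linarith, by linarith, by linarith, ?_⟩
    conv_lhs => rw [eq_ca_add_cb z]
    simp only [gridPoint]; push_cast; ring

lemma mem_down {m n : ℤ} {z : ℂ} :
    z ∈ (Cell.down m n).triangle ↔
      ca z ≤ m + 1 ∧ cb z ≤ n + 1 ∧ (m : ℝ) + n + 1 ≤ ca z + cb z := by
  rw [Cell.triangle_eq]
  simp only [unitTriangle, Cell.corner, Cell.sign, Set.mem_ofPred_eq]
  constructor
  · rintro ⟨α, β, h1, h2, h3, rfl⟩
    simp
    exact ⟨h1, h2, by linarith⟩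
  · rintro ⟨h1, h2, h3⟩
    refine ⟨m + 1 - ca z, n + 1 - cb z, by linarith, by linarith, by linarith, ?_⟩
    conv_lhs => rw [eq_ca_add_cb z]
    simp only [gridPoint]; push_cast; ring

/-- The open triangle of a cell. -/
def Cell.inner : Cell → Set ℂ
  | .up m n => {z | (m : ℝ) < ca z ∧ (n : ℝ) < cb z ∧ ca z + cb z < m + n + 1}
  | .down m n => {z | ca z < m + 1 ∧ cb z < n + 1 ∧ (m : ℝ) + n + 1 < ca z + cb z}

lemma Cell.isOpen_inner (c : Cell) : IsOpen c.inner := by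
  cases c <;> simp only [Cell.inner, Set.ofPred_and] <;>
  refine IsOpen.inter ?_ (IsOpen.inter ?_ ?_) <;>
  apply isOpen_lt <;> fun_prop

lemma Cell.inner_subset (c : Cell) : c.inner ⊆ c.triangle := by
  cases c <;> intro z hz
  · exact mem_up.2 ⟨hz.1.le, hz.2.1.le, hz.2.2.le⟩
  · exact mem_down.2 ⟨hz.1.le, hz.2.1.le, hz.2.2.le⟩

lemma Cell.isClosed_triangle (c : Cell) : IsClosed c.triangle := by
  have : c.triangle = {z | z ∈ c.triangle} := rfl
  rw [this]
  cases c <;> simp only [mem_up, mem_down, Set.ofPred_and] <;>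
  refine IsClosed.inter ?_ (IsClosed.inter ?_ ?_) <;>
  apply isClosed_le <;> fun_prop

lemma Cell.triangle_subset_closure (c : Cell) : c.triangle ⊆ closure c.inner := by
  intro z hz
  obtain ⟨w, hw⟩ : ∃ w, ∀ t : ℝ, 0 < t → t < 1 → z + t * (w - z) ∈ c.inner := by
    cases c with
    | up m n =>
      refine ⟨gridPoint m n + (((1 / 3 : ℝ) : ℂ) + ((1 / 3 : ℝ) : ℂ) * omega), fun t h0 h1 => ?_⟩
      obtain ⟨a1, a2, a3⟩ := mem_up.1 hz
      simp only [Cell.inner, Set.mem_ofPred_eq, map_add, map_sub, ca_real_mul, cb_real_mul,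
        ca_gridPoint, cb_gridPoint, ca_ofReal, cb_ofReal, ca_omega, cb_omega]
      refine ⟨?_, ?_, ?_⟩ <;> nlinarith
    | down m n =>
      refine ⟨gridPoint m n + (((2 / 3 : ℝ) : ℂ) + ((2 / 3 : ℝ) : ℂ) * omega), fun t h0 h1 => ?_⟩
      obtain ⟨a1, a2, a3⟩ := mem_down.1 hz
      simp only [Cell.inner, Set.mem_ofPred_eq, map_add, map_sub, ca_real_mul, cb_real_mul,
        ca_gridPoint, cb_gridPoint, ca_ofReal, cb_ofReal, ca_omega, cb_omega]
      refine ⟨?_, ?_, ?_⟩ <;> nlinarith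
  have ht : Filter.Tendsto (fun t : ℝ => z + t * (w - z)) (nhdsWithin 0 (Set.Ioi 0)) (nhds z) := by
    have : Continuous fun t : ℝ => z + t * (w - z) := by fun_prop
    have h := this.tendsto 0
    simp only [Complex.ofReal_zero, zero_mul, add_zero] at h
    exact h.mono_left nhdsWithin_le_nhds
  refine mem_closure_of_tendsto ht ?_
  filter_upwards [Ioo_mem_nhdsGT (zero_lt_one' ℝ)] with t ht
  exact hw t ht.1 ht.2

lemma exists_mem_triangle (z : ℂ) : ∃ c : Cell, z ∈ c.triangle := by
  rcases le_total (ca z + cb z) (⌊ca z⌋ + ⌊cb z⌋ + 1) with h | h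
  · exact ⟨.up ⌊ca z⌋ ⌊cb z⌋, mem_up.2 ⟨Int.floor_le _, Int.floor_le _, h⟩⟩
  · exact ⟨.down ⌊ca z⌋ ⌊cb z⌋,
      mem_down.2 ⟨(Int.lt_floor_add_one _).le, (Int.lt_floor_add_one _).le, h⟩⟩

lemma Cell.eq_of_mem_inner {c c' : Cell} {z : ℂ} (h : z ∈ c.inner) (h' : z ∈ c'.triangle) :
    c = c' := by
  have cast : ∀ m n : ℤ, (m : ℝ) < n + 1 → m ≤ n := fun m n hmn => by
    have : m < n + 1 := by exact_mod_cast hmn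
    omega
  cases c <;> cases c' <;> simp only [Cell.inner, Set.mem_ofPred_eq] at h
  · rename_i m n m' n'
    obtain ⟨h1, h2, h3⟩ := h
    obtain ⟨k1, k2, k3⟩ := mem_up.1 h'
    have := cast m m' (by linarith)
    have := cast m' m (by linarith)
    have := cast n n' (by linarith)
    have := cast n' n (by linarith)
    congr <;> omega
  · rename_i m n m' n'
    obtain ⟨h1, h2, h3⟩ := h
    obtain ⟨k1, k2, k3⟩ := mem_down.1 h'
    have := cast m m' (by linarith)
    have := cast n n' (by linarith)
    have := cast (m' + n' + 1) (m + n) (by push_cast; linarith)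
    omega
  · rename_i m n m' n'
    obtain ⟨h1, h2, h3⟩ := h
    obtain ⟨k1, k2, k3⟩ := mem_up.1 h'
    have := cast m' m (by linarith)
    have := cast n' n (by linarith)
    have : (m : ℝ) + n < m' + n' := by linarith
    have : m + n < m' + n' := by exact_mod_cast this
    omega
  · rename_i m n m' n'
    obtain ⟨h1, h2, h3⟩ := h
    obtain ⟨k1, k2, k3⟩ := mem_down.1 h'
    have := cast m m' (by linarith)
    have := cast m' m (by linarith)
    have := cast n n' (by linarith)
    have := cast n' n (by linarith)
    congr <;> omega

/-- The interiors of two regions made of cells meet exactly if the regions share a cell. -/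
lemma interior_region_disjoint {s t : Finset Cell} :
    Disjoint (interior (region s)) (interior (region t)) ↔ Disjoint s t := by
  rw [Finset.disjoint_left, Set.disjoint_left]
  constructor
  · intro h c hs ht
    have sub : ∀ {s : Finset Cell}, c ∈ s → c.inner ⊆ interior (region s) := fun hc =>
      interior_maximal (c.inner_subset.trans (Set.subset_biUnion_of_mem (u := Cell.triangle) hc))
        c.isOpen_inner
    obtain ⟨z, hz⟩ := c.triangle
      |>.eq_empty_or_nonempty.resolve_left (by
        rw [c.triangle_eq]
        exact Set.Nonempty.ne_empty ⟨_, 0, 0, le_rfl, le_rfl, by norm_num, rfl⟩)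
    obtain ⟨w, hw⟩ := closure_nonempty_iff.1 ⟨z, c.triangle_subset_closure hz⟩
    exact h (sub hs hw) (sub ht hw)
  · intro h z hs ht
    have hz := interior_subset hs
    simp only [region, Set.mem_iUnion, exists_prop] at hz
    obtain ⟨c, hc, hzc⟩ := hz
    obtain ⟨w, ⟨hw1, hw2⟩, hw⟩ := mem_closure_iff.1 (c.triangle_subset_closure hzc) _
      (isOpen_interior.inter isOpen_interior) ⟨hs, ht⟩
    have hw2 := interior_subset hw2
    simp only [region, Set.mem_iUnion, exists_prop] at hw2
    obtain ⟨c', hc', hwc⟩ := hw2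
    exact h hc (Cell.eq_of_mem_inner hw hwc ▸ hc')

/-! ### Placements as a group, and placements on the grid -/

lemma rot_ne_zero (x : Placement) : (x.rot : ℂ) ≠ 0 := Circle.coe_ne_zero _

/-- Composition of orientation-preserving isometries. -/
def Placement.comp (g x : Placement) : Placement := ⟨g.rot * x.rot, g.rot * x.shift + g.shift⟩

/-- The inverse isometry. -/
def Placement.inv (g : Placement) : Placement := ⟨g.rot⁻¹, -((g.rot⁻¹ : Circle) * g.shift)⟩

lemma Placement.map_comp (g x : Placement) (z : ℂ) : (g.comp x).map z = g.map (x.map z) := by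
  simp only [Placement.comp, Placement.map, Circle.coe_mul]; ring

lemma Placement.inv_comp (g : Placement) (x : Placement) : g.inv.comp (g.comp x) = x := by
  have := rot_ne_zero g
  ext1
  · simp [Placement.comp, Placement.inv]
  · simp only [Placement.comp, Placement.inv, Circle.coe_inv]; field_simp; ring

lemma Placement.comp_inv (g : Placement) (x : Placement) : g.comp (g.inv.comp x) = x := by
  have := rot_ne_zero g
  ext1
  · simp [Placement.comp, Placement.inv]
  · simp only [Placement.comp, Placement.inv, Circle.coe_inv]; field_simp; ring

lemma Placement.comp_injective (g : Placement) : Function.Injective g.comp :=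
  Function.LeftInverse.injective g.inv_comp

/-- A placement as a homeomorphism of the plane. -/
def Placement.homeo (g : Placement) : ℂ ≃ₜ ℂ where
  toFun := g.map
  invFun z := (g.rot : ℂ)⁻¹ * (z - g.shift)
  left_inv z := by
    have := rot_ne_zero g
    simp only [Placement.map]; field_simp; ring
  right_inv z := by
    have := rot_ne_zero g
    simp only [Placement.map]; field_simp; ring
  continuous_toFun := by unfold Placement.map; fun_prop
  continuous_invFun := by fun_prop

lemma Placement.interior_image (g : Placement) (s : Set ℂ) :
    interior (g.map '' s) = g.map '' interior s := (g.homeo.image_interior s).symm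

lemma Placement.map_injective (g : Placement) : Function.Injective g.map := g.homeo.injective

lemma Placement.comp_top (g x : Placement) : (g.comp x).top = g.map '' x.top := by
  simp only [Placement.top, Set.image_image, Placement.map_comp]

lemma Placement.comp_bottom (g x : Placement) : (g.comp x).bottom = g.map '' x.bottom := by
  simp only [Placement.bottom, Set.image_image, Placement.map_comp]

lemma Placement.norm_map_sub (g : Placement) (z w : ℂ) : ‖g.map z - g.map w‖ = ‖z - w‖ := by
  simp only [Placement.map]
  rw [show (g.rot : ℂ) * z + g.shift - (g.rot * w + g.shift) = g.rot * (z - w) by ring, norm_mul,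
    Circle.norm_coe, one_mul]

lemma obstructs_comp (g x y : Placement) : Obstructs (g.comp x) (g.comp y) ↔ Obstructs x y := by
  simp only [Obstructs, Placement.comp_top, Placement.comp_bottom, Placement.interior_image,
    ← Set.image_inter g.map_injective, Set.image_nonempty]

/-- Isometries map tilings to tilings. -/
lemma IsTiling.image_comp {T : Set Placement} (hT : IsTiling T) (g : Placement) :
    IsTiling (g.comp '' T) where
  cover := by
    rw [Set.biUnion_image]
    simp only [Placement.comp_top]
    rw [← Set.image_iUnion₂, hT.cover, Set.image_univ]
    exact g.homeo.surjective.range_eq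
  top_disjoint := by
    rintro _ ⟨x, hx, rfl⟩ _ ⟨y, hy, rfl⟩ hxy
    rw [Placement.comp_top, Placement.comp_top, Placement.interior_image,
      Placement.interior_image, Set.disjoint_image_iff g.map_injective]
    exact hT.top_disjoint hx hy (fun h => hxy (h ▸ rfl))
  bottom_disjoint := by
    rintro _ ⟨x, hx, rfl⟩ _ ⟨y, hy, rfl⟩ hxy
    rw [Placement.comp_bottom, Placement.comp_bottom, Placement.interior_image,
      Placement.interior_image, Set.disjoint_image_iff g.map_injective]
    exact hT.bottom_disjoint hx hy (fun h => hxy (h ▸ rfl))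
  laid := by
    classical
    intro F hF
    obtain ⟨l, h1, h2, h3⟩ := hT.laid (F.image g.inv.comp) (by
      intro x hx
      simp only [Finset.coe_image, Set.mem_image] at hx
      obtain ⟨y, hy, rfl⟩ := hx
      obtain ⟨x, hx, rfl⟩ := hF hy
      rwa [Placement.inv_comp])
    refine ⟨l.map g.comp, h1.map g.comp_injective, fun x => ?_, ?_⟩
    · simp only [List.mem_map, h2, Finset.mem_image]
      constructor
      · rintro ⟨_, ⟨y, hy, rfl⟩, rfl⟩
        rwa [Placement.comp_inv]
      · exact fun hx => ⟨_, ⟨x, hx, rfl⟩, Placement.comp_inv _ _⟩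
    · rw [List.pairwise_map]
      exact h3.imp fun h => by rwa [obstructs_comp]

/-- `ω` as a point of the unit circle. -/
def omegaCircle : Circle := ⟨omega, by simp [Submonoid.unitSphere, norm_omega]⟩

@[simp] lemma coe_omegaCircle : (omegaCircle : ℂ) = omega := rfl

lemma omegaCircle_pow_six : omegaCircle ^ 6 = 1 := by
  ext; simp [omega_pow_six]

/-- The placement on the grid that rotates by `j` times 60 degrees and then translates by the grid
point `(m, n)`. -/
def gridPlacement (j : ℕ) (p : ℤ × ℤ) : Placement := ⟨omegaCircle ^ j, gridPoint p.1 p.2⟩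

/-- Translation of cells. -/
def Cell.shift (p : ℤ × ℤ) : Cell → Cell
  | .up m n => .up (m + p.1) (n + p.2)
  | .down m n => .down (m + p.1) (n + p.2)

/-- The action of `gridPlacement j p` on cells. -/
def Cell.move (j : ℕ) (p : ℤ × ℤ) (c : Cell) : Cell := (Cell.rotate^[j] c).shift p

lemma mem_rotate {c : Cell} {z : ℂ} : omega * z ∈ c.rotate.triangle ↔ z ∈ c.triangle := by
  cases c
  · simp only [Cell.rotate, mem_up, mem_down, ca_omega_mul, cb_omega_mul]
    push_cast
    constructor <;> rintro ⟨h1, h2, h3⟩ <;> refine ⟨?_, ?_, ?_⟩ <;> linarith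
  · simp only [Cell.rotate, mem_up, mem_down, ca_omega_mul, cb_omega_mul]
    push_cast
    constructor <;> rintro ⟨h1, h2, h3⟩ <;> refine ⟨?_, ?_, ?_⟩ <;> linarith

lemma mem_shift {c : Cell} {z : ℂ} {p : ℤ × ℤ} :
    z + gridPoint p.1 p.2 ∈ (c.shift p).triangle ↔ z ∈ c.triangle := by
  cases c
  · simp only [Cell.shift, mem_up, map_add, ca_gridPoint, cb_gridPoint]
    push_cast
    constructor <;> rintro ⟨h1, h2, h3⟩ <;> refine ⟨?_, ?_, ?_⟩ <;> linarith
  · simp only [Cell.shift, mem_down, map_add, ca_gridPoint, cb_gridPoint]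
    push_cast
    constructor <;> rintro ⟨h1, h2, h3⟩ <;> refine ⟨?_, ?_, ?_⟩ <;> linarith

lemma map_mem_move {c : Cell} {z : ℂ} {j : ℕ} {p : ℤ × ℤ} :
    (gridPlacement j p).map z ∈ (c.move j p).triangle ↔ z ∈ c.triangle := by
  simp only [gridPlacement, Placement.map, Cell.move, mem_shift, Circle.coe_pow, coe_omegaCircle]
  induction j generalizing z with
  | zero => simp
  | succ j ih =>
    rw [pow_succ', mul_assoc, Function.iterate_succ_apply', mem_rotate, ih]

lemma image_triangle (c : Cell) (j : ℕ) (p : ℤ × ℤ) :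
    (gridPlacement j p).map '' c.triangle = (c.move j p).triangle := by
  ext z
  obtain ⟨w, rfl⟩ := (gridPlacement j p).homeo.surjective z
  change (gridPlacement j p).map w ∈ _ ↔ (gridPlacement j p).map w ∈ _
  rw [(Placement.map_injective _).mem_set_image, map_mem_move]

lemma image_region (s : Finset Cell) (j : ℕ) (p : ℤ × ℤ) :
    (gridPlacement j p).map '' region s = region (s.image (Cell.move j p)) := by
  simp only [region, Set.image_iUnion₂, image_triangle, Finset.set_biUnion_finset_image]

lemma gridPlacement_top (j : ℕ) (p : ℤ × ℤ) :
    (gridPlacement j p).top = region (topCells.image (Cell.move j p)) := image_region _ _ _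

lemma gridPlacement_bottom (j : ℕ) (p : ℤ × ℤ) :
    (gridPlacement j p).bottom = region (bottomCells.image (Cell.move j p)) := image_region _ _ _

/-! ### Computations with cells -/

/-- Membership in the base hexagon. -/
def Cell.inHex : Cell → Bool
  | .up m n => -3 ≤ m && m ≤ 2 && -3 ≤ n && n ≤ 2 && -3 ≤ m + n && m + n ≤ 2
  | .down m n => -3 ≤ m && m ≤ 2 && -3 ≤ n && n ≤ 2 && -4 ≤ m + n && m + n ≤ 1

lemma mem_hexagon {c : Cell} : c ∈ hexagon ↔ c.inHex := by
  cases c <;> simp [hexagon, Cell.inHex] <;> omega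

/-- Membership in the top layer. -/
def Cell.inTop (c : Cell) : Bool :=
  c.inHex && !([.up (-3) 1, .down (-2) (-2), .down 2 (-2)].contains c) ||
    [.down 1 1, .up (-2) 3, .down 1 (-4)].contains c

/-- Membership in the bottom layer. -/
def Cell.inBottom (c : Cell) : Bool :=
  c.inHex && !([.up (-3) 1, .down (-3) 1, .down (-3) 0, .down (-2) (-2), .up (-2) (-1),
    .up (-1) (-2), .down 2 (-2), .up 2 (-2), .up 2 (-1)].contains c) ||
    [.down 1 1, .up 2 1, .up 1 2].contains c

lemma topCells_eq : topCells = (hexagon \ {.up (-3) 1, .down (-2) (-2), .down 2 (-2)}) ∪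
    {.down 1 1, .up (-2) 3, .down 1 (-4)} := by
  have h1 : dent 2 ∪ dent 3 ∪ dent 5 = {.up (-3) 1, .down (-2) (-2), .down 2 (-2)} := by decide
  have h2 : bump 0 ∪ bump 1 ∪ bump 4 = {.down 1 1, .up (-2) 3, .down 1 (-4)} := by decide
  rw [topCells, h1, h2]

lemma bottomCells_eq : bottomCells = (hexagon \ {.up (-3) 1, .down (-3) 1, .down (-3) 0,
    .down (-2) (-2), .up (-2) (-1), .up (-1) (-2), .down 2 (-2), .up 2 (-2), .up 2 (-1)}) ∪
    {.down 1 1, .up 2 1, .up 1 2} := by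
  have h1 : female 2 ∪ female 3 ∪ female 5 = {.up (-3) 1, .down (-3) 1, .down (-3) 0,
    .down (-2) (-2), .up (-2) (-1), .up (-1) (-2), .down 2 (-2), .up 2 (-2), .up 2 (-1)} := by
    decide
  have h2 : male 0 = {.down 1 1, .up 2 1, .up 1 2} := by decide
  rw [bottomCells, h1, h2]

lemma mem_topCells {c : Cell} : c ∈ topCells ↔ c.inTop := by
  simp only [topCells_eq, Finset.mem_union, Finset.mem_sdiff, mem_hexagon, Cell.inTop,
    Finset.mem_insert, Finset.mem_singleton, Bool.or_eq_true, Bool.and_eq_true,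
    Bool.not_eq_true', List.contains_eq_mem, List.mem_cons, List.not_mem_nil, or_false,
    decide_eq_true_eq, decide_eq_false_iff_not]

lemma mem_bottomCells {c : Cell} : c ∈ bottomCells ↔ c.inBottom := by
  simp only [bottomCells_eq, Finset.mem_union, Finset.mem_sdiff, mem_hexagon, Cell.inBottom,
    Finset.mem_insert, Finset.mem_singleton, Bool.or_eq_true, Bool.and_eq_true,
    Bool.not_eq_true', List.contains_eq_mem, List.mem_cons, List.not_mem_nil, or_false,
    decide_eq_true_eq, decide_eq_false_iff_not]

/-- All cells with both coordinates between `-4` and `3`. -/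
def box : List Cell :=
  [-4, -3, -2, -1, 0, 1, 2, 3].flatMap fun m =>
    [-4, -3, -2, -1, 0, 1, 2, 3].flatMap fun n => [.up m n, .down m n]

/-- The cells of the top layer, as a list. -/
def topList : List Cell := box.filter Cell.inTop

/-- The grid coordinates of the centre of the hexagon at a lattice cell. -/
def center (x : ℤ × ℤ) : ℤ × ℤ := (3 * x.1 - 3 * x.2, 3 * x.1 + 6 * x.2)

/-- The translation that takes the corner of the cell `c` to that of `e`. -/
def offset (c e : Cell) : ℤ × ℤ :=
  (e.corner.1 - c.corner.1, e.corner.2 - c.corner.2)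

/-- `c` is a cell of the base hexagon at the origin that is not the middle third of a side. -/
def Cell.inCore (c : Cell) : Bool :=
  c.inHex && !([.up 1 1, .down (-2) 2, .up (-3) 1, .down (-2) (-2), .up 1 (-3),
    .down 2 (-2)].contains c)

/-- Whether `c` belongs to the image under `Cell.move j p` of the set of cells with `f`. -/
def Cell.inMove (f : Cell → Bool) (j : ℕ) (p : ℤ × ℤ) (c : Cell) : Bool :=
  f (Cell.rotate^[6 - j] (c.shift (-p)))

/-- For each side, a grid placement that takes the cells `up 0 0`, `down 0 (-1)` and `up (-1) 0` to
the position where `fill` is applied in order to find the neighbour at that side. At a side with a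
dent, `up 0 0` goes to the dent and the origin to its tip. At a side `k` with a bump, the origin
goes to the end of the side where side `k + 1` begins, and `up 0 0` to the cell outside the hexagon
at this end of side `k`. -/
def probe (k : ZMod 6) : ℕ × ℤ × ℤ :=
  (![(5, 0, 3), (0, -3, 3), (2, -2, 1), (3, -1, -1), (3, 3, -3), (5, 2, -1)] :
    Fin 6 → ℕ × ℤ × ℤ) k

/-- A grid copy of the tile that fills the dent at side `k` without overlap is the neighbour. -/
lemma dent_check : ∀ k ∈ [(2 : ZMod 6), 3, 5], ∀ j ∈ List.range 6, ∀ c ∈ topList,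
    let e := (Cell.up 0 0).move (probe k).1 (probe k).2
    let p := offset (Cell.rotate^[j] c) e
    c.move j p = e → p = center (dir k) ∨ ∃ b ∈ topList, (b.move j p).inTop := by
  decide +kernel

/-- The two cells that bound the corner at the tip of a dent belong to the tile. -/
lemma dent_probe : ∀ k ∈ [(2 : ZMod 6), 3, 5],
    ((Cell.down 0 (-1)).move (probe k).1 (probe k).2).inTop ∧
    ((Cell.up (-1) 0).move (probe k).1 (probe k).2).inTop := by
  decide +kernel

lemma dent_filled : ∀ k ∈ [(2 : ZMod 6), 3, 5], ∀ e : ZMod 6,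
    ((Cell.up 0 0).move (probe k).1 (probe k).2).inMove Cell.inTop e.val (center (dir k)) →
    isOut e (k + 3) := by
  decide +kernel

/-- A grid copy of the tile that fills the corner between side `k` and the neighbour at side
`k + 1` without overlap is the neighbour at side `k`. -/
lemma bump_check : ∀ k ∈ [(0 : ZMod 6), 1, 4], ∀ j ∈ List.range 6, ∀ c ∈ topList,
    let e := (Cell.up 0 0).move (probe k).1 (probe k).2
    let p := offset (Cell.rotate^[j] c) e
    c.move j p = e → p = center (dir k) ∨ (∃ b ∈ topList, (b.move j p).inTop) ∨
      ∃ b ∈ topList, ((b.move j p).shift (-center (dir (k + 1)))).inCore := by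
  decide +kernel

lemma bump_probe : ∀ k ∈ [(0 : ZMod 6), 1, 4],
    ((Cell.down 0 (-1)).move (probe k).1 (probe k).2).inTop ∧
    (((Cell.up (-1) 0).move (probe k).1 (probe k).2).shift (-center (dir (k + 1)))).inCore := by
  decide +kernel

/-- The core of the hexagon belongs to the top layer in all orientations. -/
lemma core_check : ∀ j ∈ List.range 6, ∀ c ∈ box, c.inCore → c.inMove Cell.inTop j 0 := by
  decide +kernel

/-- Neighbouring tiles overlap in the top layer exactly if two bumps meet. -/
lemma top_top_check : ∀ e e' k : ZMod 6,
    (∀ c ∈ box, ¬ (c.inMove Cell.inTop e.val 0 ∧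
      c.inMove Cell.inTop e'.val (center (dir k)))) ↔ ¬ (isOut e k ∧ isOut e' (k + 3)) := by
  decide +kernel

/-- Matching neighbours do not overlap in the bottom layer. -/
lemma bottom_bottom_check : ∀ e e' k : ZMod 6, isOut e k ≠ isOut e' (k + 3) →
    ∀ c ∈ box, ¬ (c.inMove Cell.inBottom e.val 0 ∧
      c.inMove Cell.inBottom e'.val (center (dir k))) := by
  decide +kernel

/-- The bottom layer of a tile reaches below the top layer of a matching neighbour exactly at the
side with the male joint. -/
lemma bottom_top_check : ∀ e e' k : ZMod 6, isOut e k ≠ isOut e' (k + 3) →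
    ((∃ c ∈ box, c.inMove Cell.inBottom e.val 0 ∧
      c.inMove Cell.inTop e'.val (center (dir k))) ↔ k = e) := by
  decide +kernel

/-- Tiles at lattice cells that are not neighbours keep apart, in both layers. -/
lemma far_check : ∀ i ∈ [(-3 : ℤ), -2, -1, 0, 1, 2, 3], ∀ j ∈ [(-1 : ℤ), 0, 1],
    (i, j) = (0, 0) ∨ (∃ k, (i, j) = dir k) ∨ ∀ c ∈ box,
      (∃ e : ZMod 6, c.inMove Cell.inTop e.val 0 ∨ c.inMove Cell.inBottom e.val 0) →
      ¬ ∃ e : ZMod 6, c.inMove Cell.inTop e.val (center (i, j)) ∨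
        c.inMove Cell.inBottom e.val (center (i, j)) := by
  decide +kernel

/-! ### Tilings are locally finite -/

lemma ball_subset_top : Metric.ball (0 : ℂ) (8 / 5) ⊆ region topCells := by
  have key : ∀ m ∈ [(-2 : ℤ), -1, 0, 1], ∀ n ∈ [(-2 : ℤ), -1, 0, 1],
      (-2 ≤ m + n → m + n ≤ 1 → (Cell.up m n).inTop) ∧
      (-3 ≤ m + n → m + n ≤ 0 → (Cell.down m n).inTop) := by decide
  have mem : ∀ m : ℤ, -2 ≤ m → m ≤ 1 → m ∈ [(-2 : ℤ), -1, 0, 1] := by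
    intro m h1 h2; simp; omega
  have cast : ∀ m n : ℤ, (m : ℝ) < n → m + 1 ≤ n := fun m n h => by
    have : m < n := by exact_mod_cast h
    omega
  intro z hz
  rw [mem_ball_zero_iff] at hz
  have hn : ca z ^ 2 + ca z * cb z + cb z ^ 2 < 64 / 25 := by
    rw [← norm_sq_eq]; nlinarith [norm_nonneg z]
  have a1 : ca z < 2 := by nlinarith [sq_nonneg (ca z + 2 * cb z)]
  have a2 : -2 < ca z := by nlinarith [sq_nonneg (ca z + 2 * cb z)]
  have b1 : cb z < 2 := by nlinarith [sq_nonneg (2 * ca z + cb z)]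
  have b2 : -2 < cb z := by nlinarith [sq_nonneg (2 * ca z + cb z)]
  have s1 : ca z + cb z < 2 := by nlinarith [sq_nonneg (ca z - cb z)]
  have s2 : -2 < ca z + cb z := by nlinarith [sq_nonneg (ca z - cb z)]
  obtain ⟨c, hc⟩ := exists_mem_triangle z
  refine Set.mem_biUnion (x := c) ?_ hc
  rw [Finset.mem_coe, mem_topCells]
  cases c with
  | up m n =>
    obtain ⟨h1, h2, h3⟩ := mem_up.1 hc
    have := cast m 2 (by push_cast; linarith)
    have := cast n 2 (by push_cast; linarith)
    have := cast (-2) (m + 1) (by push_cast; linarith)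
    have := cast (-2) (n + 1) (by push_cast; linarith)
    have := cast (-2) (m + n + 1) (by push_cast; linarith)
    have := cast (m + n) 2 (by push_cast; linarith)
    exact (key m (mem m (by omega) (by omega)) n (mem n (by omega) (by omega))).1
      (by omega) (by omega)
  | down m n =>
    obtain ⟨h1, h2, h3⟩ := mem_down.1 hc
    have := cast m 2 (by push_cast; linarith)
    have := cast n 2 (by push_cast; linarith)
    have := cast (-2) (m + 1) (by push_cast; linarith)
    have := cast (-2) (n + 1) (by push_cast; linarith)
    have := cast (-2) (m + n + 2) (by push_cast; linarith)
    have := cast (m + n + 1) 2 (by push_cast; linarith)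
    exact (key m (mem m (by omega) (by omega)) n (mem n (by omega) (by omega))).2
      (by omega) (by omega)

lemma Placement.ball_subset_interior_top (x : Placement) :
    Metric.ball x.shift (8 / 5) ⊆ interior x.top := by
  refine interior_maximal (fun z hz => ?_) Metric.isOpen_ball
  obtain ⟨w, rfl⟩ := x.homeo.surjective z
  refine ⟨w, ball_subset_top ?_, rfl⟩
  rw [Metric.mem_ball, dist_eq_norm] at hz ⊢
  rw [← x.norm_map_sub, show x.map 0 = x.shift by simp [Placement.map]]
  exact hz

variable {T : Set Placement}

/-- The centres of distinct tiles keep a distance that exceeds the covering radius `3` of the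
lattice of hexagons. -/
lemma IsTiling.le_dist (hT : IsTiling T) {x y : Placement} (hx : x ∈ T) (hy : y ∈ T)
    (hxy : x ≠ y) : 16 / 5 ≤ dist x.shift y.shift := by
  by_contra! h
  have hd : Disjoint (interior x.top) (interior y.top) := hT.top_disjoint hx hy hxy
  have h1 : midpoint ℝ x.shift y.shift ∈ interior x.top := x.ball_subset_interior_top (by
    rw [Metric.mem_ball, dist_midpoint_left]; norm_num; linarith)
  have h2 : midpoint ℝ x.shift y.shift ∈ interior y.top := y.ball_subset_interior_top (by
    rw [Metric.mem_ball, dist_midpoint_right]; norm_num; linarith)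
  exact Set.disjoint_left.1 hd h1 h2

lemma IsTiling.finite_shift (hT : IsTiling T) (z : ℂ) (R : ℝ) :
    {x ∈ T | x.shift ∈ Metric.closedBall z R}.Finite := by
  obtain ⟨t, ht, hcov⟩ := Metric.totallyBounded_iff.1
    (isCompact_closedBall z R).totallyBounded 1 one_pos
  refine (ht.biUnion (t := fun c => {x ∈ T | x.shift ∈ Metric.ball c 1}) fun c _ => ?_).subset ?_
  · refine Set.Subsingleton.finite fun x hx y hy => ?_
    by_contra hxy
    have h1 := hT.le_dist hx.1 hy.1 hxy
    have h2 := Metric.mem_ball.1 hx.2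
    have h3 := Metric.mem_ball.1 hy.2
    linarith [dist_triangle_right x.shift y.shift c]
  · rintro x ⟨hx, hxz⟩
    obtain ⟨c, hc, hxc⟩ := Set.mem_iUnion₂.1 (hcov hxz)
    exact Set.mem_biUnion hc ⟨hx, hxc⟩

lemma exists_norm_le : ∃ R : ℝ, ∀ z ∈ region topCells, ‖z‖ ≤ R := by
  have : Bornology.IsBounded (region topCells) := by
    refine (Bornology.isBounded_biUnion topCells.finite_toSet).2 fun c _ => ?_
    cases c <;> exact (isBounded_convexHull.2 (Set.toFinite _).isBounded)
  exact this.exists_norm_le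

lemma IsTiling.locallyFinite (hT : IsTiling T) : LocallyFinite fun x : T => x.1.top := by
  intro z
  obtain ⟨R, hR⟩ := exists_norm_le
  refine ⟨Metric.ball z 1, Metric.ball_mem_nhds z one_pos, ?_⟩
  refine Set.Finite.of_finite_image (f := Subtype.val) ?_ Subtype.val_injective.injOn
  refine (hT.finite_shift z (R + 1)).subset ?_
  rintro _ ⟨⟨x, hx⟩, ⟨w, ⟨v, hv, rfl⟩, hw⟩, rfl⟩
  refine ⟨hx, ?_⟩
  have h1 : dist (x.map v) x.shift = ‖v‖ := by
    have := x.norm_map_sub v 0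
    simp only [sub_zero] at this
    rw [← this, dist_eq_norm]
    simp [Placement.map]
  have h2 := hR v hv
  have h3 := Metric.mem_ball.1 hw
  rw [Metric.mem_closedBall]
  linarith [dist_triangle_left x.shift z (x.map v)]

/-! ### A unit triangle in a corner of the tiling -/

lemma convex_unitTriangle (s r : ℂ) : Convex ℝ (unitTriangle s r) := by
  have : unitTriangle s r = convexHull ℝ {s, s + r, s + r * omega} := by
    rw [convexHull_triple]
    ext z
    refine exists_congr fun α => exists_congr fun β => ?_
    rw [show s + r * (α + β * omega) = s + α * r + β * (r * omega) by ring]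
  rw [this]
  exact convex_convexHull _ _

lemma disjoint_inner_down_im {S : Set ℂ} (hS : Convex ℝ S) {δ : ℝ} (h0 : 0 < δ) (h1 : δ < 1)
    (hδ : (δ : ℂ) ∈ S) (hd : Disjoint S (Cell.down 0 (-1)).inner) {z : ℂ} (hz : z ∈ S) :
    0 ≤ cb z := by
  by_contra! hneg
  obtain ⟨t, t0, t1, t2, t3⟩ : ∃ t : ℝ, 0 < t ∧ t ≤ 1 ∧ t * (|ca z| + |cb z| + 1) < δ ∧
      t * (|ca z| + |cb z| + 1) < 1 - δ := by
    have hM : 1 ≤ |ca z| + |cb z| + 1 := by linarith [abs_nonneg (ca z), abs_nonneg (cb z)]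
    have hp : 0 < δ * (1 - δ) := mul_pos h0 (by linarith)
    refine ⟨δ * (1 - δ) / 2 / (|ca z| + |cb z| + 1), by positivity, ?_, ?_, ?_⟩
    · rw [div_le_one (by positivity)]; nlinarith
    · rw [div_mul_cancel₀ _ (by positivity)]; nlinarith
    · rw [div_mul_cancel₀ _ (by positivity)]; nlinarith
  have hmem : ((1 - t : ℝ) • (δ : ℂ) + t • z) ∈ S :=
    hS hδ hz (by linarith) t0.le (by ring)
  refine Set.disjoint_left.1 hd hmem ?_
  have a1 := le_abs_self (ca z)
  have a2 := neg_abs_le (ca z)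
  have b2 := neg_abs_le (cb z)
  have b1 := abs_nonneg (cb z)
  simp only [Cell.inner, Set.mem_ofPred_eq, map_add, map_smul, ca_ofReal, cb_ofReal, smul_eq_mul]
  push_cast
  refine ⟨?_, ?_, ?_⟩ <;> nlinarith

set_option maxHeartbeats 1000000 in
/-- A unit triangle that reaches along the positive real axis to the origin, and is kept from the
lower side of this axis by one cell and from the left of the origin by another, is the triangle of
the cell `up 0 0`. The three cases differ in which of its vertices is at the origin. -/
lemma unitTriangle_in_corner {s r : ℂ} (hr : ‖r‖ = 1) {δ : ℝ} (hδ0 : 0 < δ) (hδ1 : δ < 1)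
    (h0 : (0 : ℂ) ∈ unitTriangle s r) (hδ : (δ : ℂ) ∈ unitTriangle s r)
    (hdown : Disjoint (unitTriangle s r) (Cell.down 0 (-1)).inner)
    (hup : Disjoint (unitTriangle s r) (Cell.up (-1) 0).inner) :
    (r = 1 ∧ s = gridPoint 0 0) ∨ (r = omega ^ 2 ∧ s = gridPoint 1 0) ∨
      (r = omega ^ 4 ∧ s = gridPoint 0 1) := by
  have hpos : ∀ z ∈ unitTriangle s r, 0 ≤ cb z := fun z hz =>
    disjoint_inner_down_im (convex_unitTriangle s r) hδ0 hδ1 hδ hdown hz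
  have ca_pt : ∀ α β : ℝ, ca (s + r * (α + β * omega)) = ca s + α * ca r - β * cb r := by
    intro α β
    rw [show s + r * (α + β * omega) = s + ((α : ℂ) * r + (β : ℂ) * (omega * r)) by ring]
    simp only [map_add, ca_real_mul, ca_omega_mul]; ring
  have cb_pt : ∀ α β : ℝ, cb (s + r * (α + β * omega)) =
      cb s + α * cb r + β * (ca r + cb r) := by
    intro α β
    rw [show s + r * (α + β * omega) = s + ((α : ℂ) * r + (β : ℂ) * (omega * r)) by ring]
    simp only [map_add, cb_real_mul, cb_omega_mul]; ring
  have hK : ∀ α β : ℝ, 0 ≤ α → 0 ≤ β → α + β ≤ 1 →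
      -1 < ca s + α * ca r - β * cb r → 0 < cb s + α * cb r + β * (ca r + cb r) →
      ca s + α * ca r - β * cb r + (cb s + α * cb r + β * (ca r + cb r)) < 0 → False := by
    intro α β p1 p2 p3 q1 q2 q3
    refine Set.disjoint_left.1 hup ⟨α, β, p1, p2, p3, rfl⟩ ?_
    simp only [Cell.inner, Set.mem_ofPred_eq, ca_pt, cb_pt]
    push_cast
    exact ⟨q1, q2, by linarith⟩
  have v0 := hpos _ ⟨0, 0, le_rfl, le_rfl, by norm_num, rfl⟩
  have v1 := hpos _ ⟨1, 0, zero_le_one, le_rfl, by norm_num, rfl⟩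
  have v2 := hpos _ ⟨0, 1, le_rfl, zero_le_one, by norm_num, rfl⟩
  rw [cb_pt] at v0 v1 v2
  obtain ⟨α, β, hα, hβ, hαβ, e0⟩ := h0
  obtain ⟨γ, ε, hγ, hε, hγε, e1⟩ := hδ
  have ea := congrArg ca e0
  have eb := congrArg cb e0
  have fa := congrArg ca e1
  have fb := congrArg cb e1
  rw [ca_pt] at ea fa
  rw [cb_pt] at eb fb
  simp only [map_zero, ca_ofReal, cb_ofReal] at ea eb fa fb
  have hn : ca r ^ 2 + ca r * cb r + cb r ^ 2 = 1 := by rw [← norm_sq_eq, hr]; norm_num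
  have om2 : omega ^ 2 = omega - 1 := by rw [pow_two, omega_sq]
  have om4 : omega ^ 4 = -omega := by linear_combination omega * omega_pow_three
  -- the heights of the three vertices and the weights of the two given points
  set u := ca r with hu
  set v := cb r with hv
  set a := ca s with ha
  set b := cb s with hb
  have w0 : b * (1 - α - β) = 0 ∧ (b + v) * α = 0 ∧ (b + u + v) * β = 0 := by
    have p0 : 0 ≤ b * (1 - α - β) := mul_nonneg (by linarith) (by linarith)
    have p1 : 0 ≤ (b + v) * α := mul_nonneg (by linarith) hα
    have p2 : 0 ≤ (b + u + v) * β := mul_nonneg (by linarith) hβ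
    refine ⟨?_, ?_, ?_⟩ <;> nlinarith
  have w1 : b * (1 - γ - ε) = 0 ∧ (b + v) * γ = 0 ∧ (b + u + v) * ε = 0 := by
    have p0 : 0 ≤ b * (1 - γ - ε) := mul_nonneg (by linarith) (by linarith)
    have p1 : 0 ≤ (b + v) * γ := mul_nonneg (by linarith) hγ
    have p2 : 0 ≤ (b + u + v) * ε := mul_nonneg (by linarith) hε
    refine ⟨?_, ?_, ?_⟩ <;> nlinarith
  simp only [mul_eq_zero] at w0 w1
  obtain ⟨x0, x1, x2⟩ := w0
  obtain ⟨y0, y1, y2⟩ := w1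
  by_cases hb0 : b = 0
  · by_cases hv0 : b + v = 0
    · -- the edge from `s` to `s + r` lies on the axis
      have hv' : v = 0 := by linarith
      have hu1 : u = 1 := by
        rw [hv'] at hn v2; nlinarith
      have ha0 : a = 0 := by
        have l1 : a ≤ 0 := by rw [hu1, hv'] at ea; linarith
        have l2 : -1 < a := by rw [hu1, hv'] at fa; linarith
        by_contra hne
        have : a < 0 := lt_of_le_of_ne l1 hne
        refine hK (-a / 2) (-a / 4) (by linarith) (by linarith) (by linarith) ?_ ?_ ?_ <;>
          rw [hu1, hv'] <;> linarith
      left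
      refine ⟨ext_coord ?_ ?_, ext_coord ?_ ?_⟩
      · rw [← hu, hu1, ca_one]
      · rw [← hv, hv', cb_one]
      · rw [← ha, ha0, ca_gridPoint, Int.cast_zero]
      · rw [← hb, hb0, cb_gridPoint, Int.cast_zero]
    · by_cases huv : b + u + v = 0
      · -- the edge from `s + r ω` to `s` lies on the axis
        have hα0 : α = 0 := x1.resolve_left hv0
        have hγ0 : γ = 0 := y1.resolve_left hv0
        have hu' : u = -v := by linarith
        have hv1 : v = 1 := by
          rw [hu'] at hn; nlinarith
        have ha1 : a = 1 := by
          have l1 : a ≤ 1 := by rw [hα0, hv1] at ea; linarith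
          have l2 : 0 < a := by rw [hγ0, hv1] at fa; linarith
          by_contra hne
          have : a < 1 := lt_of_le_of_ne l1 hne
          refine hK ((1 - a) / 4) ((3 * a + 1) / 4) (by linarith) (by linarith) (by linarith)
            ?_ ?_ ?_ <;> rw [hu', hv1] <;> linarith
        right; left
        refine ⟨ext_coord ?_ ?_, ext_coord ?_ ?_⟩
        · rw [← hu, hu', hv1, om2, map_sub, ca_omega, ca_one, zero_sub]
        · rw [← hv, hv1, om2, map_sub, cb_omega, cb_one, sub_zero]
        · rw [← ha, ha1, ca_gridPoint, Int.cast_one]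
        · rw [← hb, hb0, cb_gridPoint, Int.cast_zero]
      · exfalso
        have hα0 := x1.resolve_left hv0
        have hγ0 := y1.resolve_left hv0
        have hβ0 := x2.resolve_left huv
        have hε0 := y2.resolve_left huv
        rw [hα0, hβ0] at ea
        rw [hγ0, hε0] at fa
        linarith
  · have h1 := x0.resolve_left hb0
    have h2 := y0.resolve_left hb0
    by_cases hv0 : b + v = 0
    · by_cases huv : b + u + v = 0
      · -- the edge from `s + r` to `s + r ω` lies on the axis
        have hu' : u = 0 := by linarith
        have hv1 : v = -1 := by
          rw [hu'] at hn; nlinarith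
        have ha0 : a = 0 := by
          have l1 : a ≤ 0 := by rw [hu', hv1] at ea; linarith
          have l2 : -1 < a := by rw [hu', hv1] at fa; linarith
          by_contra hne
          have : a < 0 := lt_of_le_of_ne l1 hne
          refine hK (1 + 3 * a / 4) (-a / 2) (by linarith) (by linarith) (by linarith)
            ?_ ?_ ?_ <;> rw [hu', hv1] <;> linarith
        right; right
        refine ⟨ext_coord ?_ ?_, ext_coord ?_ ?_⟩
        · rw [← hu, hu', om4, map_neg, ca_omega, neg_zero]
        · rw [← hv, hv1, om4, map_neg, cb_omega]
        · rw [← ha, ha0, ca_gridPoint, Int.cast_zero]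
        · rw [← hb, cb_gridPoint, Int.cast_one]; linarith
      · exfalso
        have hβ0 := x2.resolve_left huv
        have hε0 := y2.resolve_left huv
        have hα1 : α = 1 := by linarith
        have hγ1 : γ = 1 := by linarith
        rw [hα1, hβ0] at ea
        rw [hγ1, hε0] at fa
        linarith
    · exfalso
      have hα0 := x1.resolve_left hv0
      have hγ0 := y1.resolve_left hv0
      have hβ1 : β = 1 := by linarith
      have hε1 : ε = 1 := by linarith
      rw [hα0, hβ1] at ea
      rw [hγ0, hε1] at fa
      linarith

/-! ### The tile that fills a corner lies on the grid -/

/-- Some tile of `T` has the triangle of the cell `c` as one of its triangles. -/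
def HasCell (T : Set Placement) (c : Cell) : Prop :=
  ∃ x ∈ T, ∃ c' ∈ topCells, x.map '' c'.triangle = c.triangle

lemma image_triangle_eq (x : Placement) (c : Cell) : x.map '' c.triangle =
    unitTriangle (x.map (gridPoint c.corner.1 c.corner.2)) (x.rot * c.sign) := by
  rw [Cell.triangle_eq]
  ext z
  simp only [unitTriangle, Set.mem_image, Set.mem_ofPred_eq, Placement.map]
  constructor
  · rintro ⟨_, ⟨α, β, h1, h2, h3, rfl⟩, rfl⟩
    exact ⟨α, β, h1, h2, h3, by ring⟩
  · rintro ⟨α, β, h1, h2, h3, rfl⟩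
    exact ⟨_, ⟨α, β, h1, h2, h3, rfl⟩, by ring⟩

lemma Cell.norm_sign (c : Cell) : ‖((c.sign : ℤ) : ℂ)‖ = 1 := by
  cases c <;> simp [Cell.sign]

lemma Placement.image_triangle_subset_top (x : Placement) {c : Cell} (hc : c ∈ topCells) :
    x.map '' c.triangle ⊆ x.top :=
  Set.image_mono (Set.subset_biUnion_of_mem (u := Cell.triangle) hc)

lemma Placement.isClosed_image_triangle (x : Placement) (c : Cell) :
    IsClosed (x.map '' c.triangle) := x.homeo.isClosedMap _ c.isClosed_triangle

/-- The triangles of the tiles of a tiling are disjoint up to their boundaries. -/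
lemma IsTiling.disjoint_triangles (hT : IsTiling T) {x y : Placement} (hx : x ∈ T) (hy : y ∈ T)
    {c c' : Cell} (hc : c ∈ topCells) (hc' : c' ∈ topCells) (hne : ¬ (x = y ∧ c = c')) :
    Disjoint (x.map '' c.triangle) (interior (y.map '' c'.triangle)) := by
  rw [Set.disjoint_left]
  rintro _ ⟨z, hz, rfl⟩ hz'
  have hcl : x.map z ∈ closure (x.map '' c.inner) := by
    have := x.homeo.image_closure c.inner
    change x.map '' _ = closure (x.map '' _) at this
    rw [← this]
    exact ⟨z, c.triangle_subset_closure hz, rfl⟩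
  obtain ⟨w, hw, hw'⟩ := mem_closure_iff.1 hcl _ isOpen_interior hz'
  by_cases hxy : x = y
  · subst hxy
    obtain ⟨v, hv, rfl⟩ := hw'
    obtain ⟨v', hv', h⟩ := interior_subset hw
    have hvv : v' = v := x.map_injective h
    subst hvv
    exact hne ⟨rfl, Cell.eq_of_mem_inner hv hv'⟩
  · have hd : Disjoint (interior x.top) (interior y.top) := hT.top_disjoint hx hy hxy
    refine Set.disjoint_left.1 hd ?_ (interior_mono (y.image_triangle_subset_top hc') hw)
    refine interior_maximal ((Set.image_mono c.inner_subset).trans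
      (x.image_triangle_subset_top hc)) ?_ hw'
    exact x.homeo.isOpenMap _ c.isOpen_inner

lemma omegaCircle_pow_mod (j : ℕ) : omegaCircle ^ (j % 6) = omegaCircle ^ j := by
  conv_rhs => rw [← Nat.div_add_mod j 6, pow_add, pow_mul, omegaCircle_pow_six, one_pow, one_mul]

lemma omega_mul_gridPoint (m n : ℤ) : omega * gridPoint m n = gridPoint (-n) (m + n) := by
  apply ext_coord <;> simp

lemma exists_omega_pow_mul_gridPoint (j : ℕ) (p : ℤ × ℤ) :
    ∃ q : ℤ × ℤ, omega ^ j * gridPoint p.1 p.2 = gridPoint q.1 q.2 := by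
  induction j with
  | zero => exact ⟨p, by simp⟩
  | succ j ih =>
    obtain ⟨q, hq⟩ := ih
    exact ⟨(-q.2, q.1 + q.2), by rw [pow_succ', mul_assoc, hq, omega_mul_gridPoint]⟩

/-- A placement whose rotation is a power of `ω` and which maps some grid point to a grid point
lies on the grid. -/
lemma eq_gridPlacement {x : Placement} {j : ℕ} {p q : ℤ × ℤ} (hr : (x.rot : ℂ) = omega ^ j)
    (hm : x.map (gridPoint p.1 p.2) = gridPoint q.1 q.2) :
    ∃ j' < 6, ∃ p', x = gridPlacement j' p' := by
  obtain ⟨t, ht⟩ := exists_omega_pow_mul_gridPoint j p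
  refine ⟨j % 6, Nat.mod_lt _ (by norm_num), q - t, ?_⟩
  ext1
  · simp only [gridPlacement, omegaCircle_pow_mod]
    ext
    simp [hr]
  · simp only [Placement.map, hr, ht] at hm
    simp only [gridPlacement]
    rw [eq_sub_of_add_eq' hm]
    apply ext_coord <;> simp

/-- If a corner of the plane is bounded by the cells `down 0 (-1)` and `up (-1) 0` of a tiling, then
the tile in this corner that continues along the first of these cells lies on the grid and has
`up 0 0` as one of its cells. -/
lemma IsTiling.fill_zero (hT : IsTiling T) (hdown : HasCell T (.down 0 (-1)))
    (hup : HasCell T (.up (-1) 0)) : ∃ j < 6, ∃ p, gridPlacement j p ∈ T ∧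
      ∃ c ∈ topCells, c.move j p = .up 0 0 := by
  obtain ⟨x1, hx1, c1, hc1, e1⟩ := hdown
  obtain ⟨x2, hx2, c2, hc2, e2⟩ := hup
  -- the union of those triangles that avoid a given set is closed
  have closed : ∀ P : Placement → Cell → Prop, IsClosed (⋃ x : T, ⋃ c ∈ topCells, ⋃ _ : P x.1 c,
      x.1.map '' c.triangle) := by
    intro P
    have lf : LocallyFinite fun x : T => ⋃ c ∈ topCells, ⋃ _ : P x.1 c, x.1.map '' c.triangle :=
      hT.locallyFinite.subset fun x => Set.iUnion₂_subset fun c hc => Set.iUnion_subset fun _ =>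
        x.1.image_triangle_subset_top hc
    refine lf.isClosed_iUnion fun x => ?_
    refine topCells.finite_toSet.isClosed_biUnion fun c _ => ?_
    exact isClosed_iUnion_of_finite fun _ => x.1.isClosed_image_triangle c
  have covered : ∀ z : ℂ, ∃ x ∈ T, ∃ c ∈ topCells, z ∈ x.map '' c.triangle := by
    intro z
    have hz : z ∈ ⋃ x ∈ T, x.top := hT.cover ▸ Set.mem_univ z
    obtain ⟨x, hx, w, hw, rfl⟩ := Set.mem_iUnion₂.1 hz
    obtain ⟨c, hc, hwc⟩ := Set.mem_iUnion₂.1 hw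
    exact ⟨x, hx, c, hc, w, hwc, rfl⟩
  have other : ∀ z ∈ (Cell.up 0 0).triangle, ∃ x ∈ T, ∃ c ∈ topCells,
      (¬ (x = x1 ∧ c = c1) ∧ ¬ (x = x2 ∧ c = c2)) ∧ z ∈ x.map '' c.triangle := by
    intro z hz
    have hsub : (Cell.up 0 0).inner ⊆ _ :=
      fun w hw => show w ∈ ⋃ x : T, ⋃ c ∈ topCells, ⋃ _ : (¬ (x.1 = x1 ∧ c = c1) ∧
          ¬ (x.1 = x2 ∧ c = c2)), x.1.map '' c.triangle by
        obtain ⟨x, hx, c, hc, hwc⟩ := covered w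
        simp only [Set.mem_iUnion]
        refine ⟨⟨x, hx⟩, c, hc, ⟨?_, ?_⟩, hwc⟩
        · rintro ⟨rfl, rfl⟩
          rw [e1] at hwc
          simpa using Cell.eq_of_mem_inner hw hwc
        · rintro ⟨rfl, rfl⟩
          rw [e2] at hwc
          simpa using Cell.eq_of_mem_inner hw hwc
    have := (closure_minimal hsub (closed fun x c => ¬ (x = x1 ∧ c = c1) ∧ ¬ (x = x2 ∧ c = c2)))
      (Cell.triangle_subset_closure _ hz)
    simp only [Set.mem_iUnion] at this
    obtain ⟨x, c, hc, hP, hz⟩ := this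
    exact ⟨x.1, x.2, c, hc, hP, hz⟩
  -- close to the origin all triangles contain the origin
  obtain ⟨ε, hε, hball⟩ := Metric.isOpen_iff.1 (closed fun x c =>
    (0 : ℂ) ∉ x.map '' c.triangle).isOpen_compl 0 (by
      simp only [Set.mem_compl_iff, Set.mem_iUnion, not_exists]
      exact fun x c hc hP h => hP h)
  obtain ⟨δ, hδ0, hδ⟩ := exists_between (lt_min hε one_pos)
  obtain ⟨hδε, hδ1⟩ := lt_min_iff.1 hδ
  obtain ⟨x, hx, c, hc, ⟨hne1, hne2⟩, hδx⟩ := other (δ : ℂ) (mem_up.2 (by simp [hδ0.le, hδ1.le]))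
  have h0x : (0 : ℂ) ∈ x.map '' c.triangle := by
    by_contra h
    refine hball (a := (δ : ℂ)) (by simp [abs_of_pos hδ0, hδε]) ?_
    simp only [Set.mem_iUnion]
    exact ⟨⟨x, hx⟩, c, hc, h, hδx⟩
  have d1 : Disjoint (x.map '' c.triangle) (Cell.down 0 (-1)).inner := by
    refine (hT.disjoint_triangles hx hx1 hc hc1 hne1).mono_right ?_
    rw [e1]
    exact interior_maximal (Cell.inner_subset _) (Cell.isOpen_inner _)
  have d2 : Disjoint (x.map '' c.triangle) (Cell.up (-1) 0).inner := by
    refine (hT.disjoint_triangles hx hx2 hc hc2 hne2).mono_right ?_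
    rw [e2]
    exact interior_maximal (Cell.inner_subset _) (Cell.isOpen_inner _)
  -- the centroid of `up 0 0` tells that the triangle found is that of this cell
  have finish : ∀ j : ℕ, ∀ q : ℤ × ℤ, (x.rot * c.sign : ℂ) = omega ^ j →
      x.map (gridPoint c.corner.1 c.corner.2) = gridPoint q.1 q.2 →
      gridPoint q.1 q.2 + omega ^ j * ((1 / 3 : ℝ) + (1 / 3 : ℝ) * omega) =
        (1 / 3 : ℝ) + (1 / 3 : ℝ) * omega →
      ∃ j < 6, ∃ p, gridPlacement j p ∈ T ∧ ∃ c ∈ topCells, c.move j p = .up 0 0 := by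
    intro j q hr hs hcen
    have hrot : ∃ j', (x.rot : ℂ) = omega ^ j' := by
      cases c with
      | up m n => exact ⟨j, by simpa [Cell.sign] using hr⟩
      | down m n =>
        refine ⟨j + 3, ?_⟩
        simp only [Cell.sign] at hr
        push_cast at hr
        rw [pow_add, omega_pow_three, ← hr]; ring
    obtain ⟨j', hj'⟩ := hrot
    obtain ⟨j'', hlt, p, rfl⟩ := eq_gridPlacement hj' hs
    refine ⟨j'', hlt, p, hx, c, hc, ?_⟩
    have hmem : ((1 / 3 : ℝ) + (1 / 3 : ℝ) * omega : ℂ) ∈ (c.move j'' p).triangle := by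
      rw [← image_triangle, image_triangle_eq, hs, hr]
      exact ⟨1 / 3, 1 / 3, by norm_num, by norm_num, by norm_num, hcen.symm⟩
    refine (Cell.eq_of_mem_inner ?_ hmem).symm
    simp only [Cell.inner, Set.mem_ofPred_eq, map_add, ca_real_mul, cb_real_mul, ca_ofReal,
      cb_ofReal, ca_omega, cb_omega]
    norm_num
  rw [image_triangle_eq] at h0x hδx d1 d2
  have hnorm : ‖(x.rot * c.sign : ℂ)‖ = 1 := by
    rw [norm_mul, Circle.norm_coe, Cell.norm_sign, one_mul]
  rcases unitTriangle_in_corner hnorm hδ0 hδ1 h0x hδx d1 d2 with ⟨h1, h2⟩ | ⟨h1, h2⟩ | ⟨h1, h2⟩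
  · exact finish 0 (0, 0) (by simpa using h1) h2 (by simp [gridPoint])
  · refine finish 2 (1, 0) h1 h2 ?_
    simp only [gridPoint]
    push_cast
    linear_combination (1 / 3 : ℂ) * omega_sq + (1 / 3 : ℂ) * omega_pow_three
  · refine finish 4 (0, 1) h1 h2 ?_
    simp only [gridPoint]
    push_cast
    linear_combination (1 / 3 : ℂ) * (omega + omega ^ 2) * omega_pow_three - (1 / 3 : ℂ) * omega_sq

/-! ### Tiles on the lattice of hexagons -/

/-- The tile with orientation `e` at the lattice cell `x`. -/
def tile (e : ZMod 6) (x : ℤ × ℤ) : Placement := gridPlacement e.val (center x)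

lemma Cell.triangle_injective : Function.Injective Cell.triangle := by
  intro c c' h
  obtain ⟨w, hw⟩ : c.inner.Nonempty := closure_nonempty_iff.1
    (Set.Nonempty.mono c.triangle_subset_closure (by
      rw [c.triangle_eq]; exact ⟨_, 0, 0, le_rfl, le_rfl, by norm_num, rfl⟩))
  exact Cell.eq_of_mem_inner hw (h ▸ c.inner_subset hw)

lemma HasCell.inv_comp {g : Placement} {c c' : Cell} (hg : g.map '' c'.triangle = c.triangle)
    (h : HasCell T c) : HasCell (g.inv.comp '' T) c' := by
  obtain ⟨x, hx, b, hb, e⟩ := h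
  refine ⟨_, ⟨x, hx, rfl⟩, b, hb, ?_⟩
  have h1 : ∀ z, g.inv.map (g.map z) = z := by
    intro z
    have := rot_ne_zero g
    simp only [Placement.map, Placement.inv, Circle.coe_inv]; field_simp; ring
  simp only [Placement.map_comp]
  rw [← Set.image_image g.inv.map, e, ← hg, Set.image_image]
  simp [h1]

/-- The images of `down 0 (-1)` and `up (-1) 0` under a grid placement bound a corner in which a
tile on the grid has the image of `up 0 0` as one of its cells. -/
lemma IsTiling.fill (hT : IsTiling T) {j : ℕ} {p : ℤ × ℤ}
    (hdown : HasCell T ((Cell.down 0 (-1)).move j p))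
    (hup : HasCell T ((Cell.up (-1) 0).move j p)) :
    ∃ j' < 6, ∃ p', gridPlacement j' p' ∈ T ∧
      ∃ c ∈ topCells, c.move j' p' = (Cell.up 0 0).move j p := by
  set g := gridPlacement j p with hg
  obtain ⟨j1, -, p1, ⟨y, hy, hyg⟩, c, hc, hm⟩ :=
    (hT.image_comp g.inv).fill_zero (hdown.inv_comp (image_triangle _ j p))
      (hup.inv_comp (image_triangle _ j p))
  obtain rfl : y = g.comp (gridPlacement j1 p1) := by rw [← hyg, Placement.comp_inv]
  obtain ⟨t, ht⟩ := exists_omega_pow_mul_gridPoint j p1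
  obtain ⟨j', hj', p', hp'⟩ := eq_gridPlacement (x := g.comp (gridPlacement j1 p1)) (j := j + j1)
    (p := (0, 0)) (q := t + p) (by simp [hg, gridPlacement, Placement.comp, pow_add]) (by
      rw [Placement.map_comp]
      simp only [hg, gridPlacement, Placement.map, Circle.coe_pow, coe_omegaCircle]
      rw [show gridPoint 0 0 = 0 by simp [gridPoint], mul_zero, zero_add, ht]
      apply ext_coord <;> simp)
  refine ⟨j', hj', p', hp' ▸ hy, c, hc, Cell.triangle_injective ?_⟩
  rw [← image_triangle, ← image_triangle, ← hp', ← hm, ← image_triangle, Set.image_image]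
  simp only [Placement.map_comp]
  rfl

lemma Cell.rotate_iterate_six (c : Cell) : Cell.rotate^[6] c = c := by
  cases c <;> simp [Cell.rotate] <;> constructor <;> ring

@[simp] lemma Cell.shift_zero (c : Cell) : c.shift 0 = c := by cases c <;> simp [Cell.shift]

lemma Cell.shift_shift (c : Cell) (p q : ℤ × ℤ) : (c.shift p).shift q = c.shift (p + q) := by
  cases c <;> simp [Cell.shift] <;> constructor <;> ring

lemma mem_image_move {s : Finset Cell} {f : Cell → Bool} (hf : ∀ c, c ∈ s ↔ f c) {j : ℕ}
    (hj : j < 6) {p : ℤ × ℤ} {c : Cell} : c ∈ s.image (Cell.move j p) ↔ c.inMove f j p := by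
  simp only [Finset.mem_image, Cell.inMove, ← hf, Cell.move]
  constructor
  · rintro ⟨b, hb, rfl⟩
    rwa [Cell.shift_shift, add_neg_cancel, Cell.shift_zero, ← Function.iterate_add_apply,
      Nat.sub_add_cancel hj.le, Cell.rotate_iterate_six]
  · intro h
    refine ⟨_, h, ?_⟩
    rw [← Function.iterate_add_apply, Nat.add_sub_cancel' hj.le, Cell.rotate_iterate_six,
      Cell.shift_shift, neg_add_cancel, Cell.shift_zero]

lemma Cell.inMove_shift (f : Cell → Bool) (j : ℕ) (p q : ℤ × ℤ) (c : Cell) :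
    (c.shift q).inMove f j (p + q) = c.inMove f j p := by
  simp only [Cell.inMove, Cell.shift_shift]
  congr 3
  abel

lemma mem_box_of_inHex {c : Cell} (h : c.inHex) : c ∈ box := by
  have key : ∀ m : ℤ, -3 ≤ m → m ≤ 2 → m ∈ [(-4 : ℤ), -3, -2, -1, 0, 1, 2, 3] := by
    intro m _ _
    simp only [List.mem_cons, List.not_mem_nil]
    omega
  cases c with
  | up m n | down m n =>
    simp only [Cell.inHex, Bool.and_eq_true, decide_eq_true_eq] at h
    exact List.mem_flatMap.2 ⟨m, key m (by omega) (by omega),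
      List.mem_flatMap.2 ⟨n, key n (by omega) (by omega), by simp⟩⟩

lemma mem_box {c : Cell} (h : c.inTop ∨ c.inBottom) : c ∈ box := by
  have key : c.inHex ∨ c ∈ [.down 1 1, .up (-2) 3, .down 1 (-4)] ∨
      c ∈ [.down 1 1, .up 2 1, .up 1 2] := by
    simp only [Cell.inTop, Cell.inBottom, Bool.or_eq_true, Bool.and_eq_true, List.contains_eq_mem,
      decide_eq_true_eq] at h
    tauto
  rcases key with h | h | h
  · exact mem_box_of_inHex h
  · have check : ∀ c ∈ [Cell.down 1 1, .up (-2) 3, .down 1 (-4)], c ∈ box := by decide +kernel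
    exact check c h
  · have check : ∀ c ∈ [Cell.down 1 1, .up 2 1, .up 1 2], c ∈ box := by decide +kernel
    exact check c h

lemma mem_topList {c : Cell} : c ∈ topList ↔ c ∈ topCells := by
  rw [topList, List.mem_filter, mem_topCells]
  exact ⟨fun h => h.2, fun h => ⟨mem_box (.inl h), h⟩⟩

lemma box_check : ∀ j ∈ List.range 6, ∀ c ∈ box, c.inTop ∨ c.inBottom →
    Cell.rotate^[j] c ∈ box := by
  decide +kernel

lemma mem_box_of_inMove {f : Cell → Bool} (hf : ∀ c, f c → c.inTop ∨ c.inBottom) {j : ℕ}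
    (hj : j < 6) {c : Cell} (h : c.inMove f j 0) : c ∈ box := by
  simp only [Cell.inMove, neg_zero, Cell.shift_zero] at h
  have := box_check j (List.mem_range.2 hj) _ (mem_box (hf _ h)) (hf _ h)
  rwa [← Function.iterate_add_apply, Nat.add_sub_cancel' hj.le, Cell.rotate_iterate_six] at this

lemma center_add (x y : ℤ × ℤ) : center (x + y) = center x + center y := by
  ext <;> simp [center] <;> ring

lemma val_lt (e : ZMod 6) : e.val < 6 := ZMod.val_lt e

lemma mem_tile_top {e : ZMod 6} {x : ℤ × ℤ} {c : Cell} :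
    c ∈ topCells.image (Cell.move e.val (center x)) ↔ c.inMove Cell.inTop e.val (center x) :=
  mem_image_move (fun _ => mem_topCells) (val_lt e)

lemma mem_tile_bottom {e : ZMod 6} {x : ℤ × ℤ} {c : Cell} :
    c ∈ bottomCells.image (Cell.move e.val (center x)) ↔
      c.inMove Cell.inBottom e.val (center x) :=
  mem_image_move (fun _ => mem_bottomCells) (val_lt e)

lemma disjoint_top_iff {j j' : ℕ} {p p' : ℤ × ℤ} :
    Disjoint (interior (gridPlacement j p).top) (interior (gridPlacement j' p').top) ↔
      Disjoint (topCells.image (Cell.move j p)) (topCells.image (Cell.move j' p')) := by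
  rw [gridPlacement_top, gridPlacement_top, interior_region_disjoint]

lemma IsTiling.not_mem_both (hT : IsTiling T) {j j' : ℕ} {p p' : ℤ × ℤ} {b : Cell}
    (h : gridPlacement j p ∈ T) (h' : gridPlacement j' p' ∈ T)
    (hb : b ∈ topCells.image (Cell.move j p)) (hb' : b ∈ topCells.image (Cell.move j' p')) :
    gridPlacement j p = gridPlacement j' p' := by
  by_contra hne
  exact Finset.disjoint_left.1 (disjoint_top_iff.1 (hT.top_disjoint h h' hne)) hb hb'

lemma gridPlacement_injective_aux {j j' : ℕ} {p p' : ℤ × ℤ}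
    (h : gridPlacement j p = gridPlacement j' p') (c : Cell) : c.move j p = c.move j' p' := by
  apply Cell.triangle_injective
  rw [← image_triangle, ← image_triangle, h]

lemma tile_zero_zero : tile 0 0 = gridPlacement 0 0 := rfl

lemma move_zero_zero (c : Cell) : c.move 0 0 = c := by simp [Cell.move]

lemma offset_shift (c : Cell) (p : ℤ × ℤ) : offset c (c.shift p) = p := by
  cases c <;> ext <;> simp [offset, Cell.shift, Cell.corner]

lemma hasCell_of_mem {j : ℕ} {p : ℤ × ℤ} {c : Cell} (h : gridPlacement j p ∈ T)
    (hc : c ∈ topCells.image (Cell.move j p)) : HasCell T c := by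
  obtain ⟨b, hb, rfl⟩ := Finset.mem_image.1 hc
  exact ⟨_, h, b, hb, image_triangle _ _ _⟩

lemma probe_free : ∀ k : ZMod 6, ¬ ((Cell.up 0 0).move (probe k).1 (probe k).2).inTop := by
  decide +kernel

lemma probe_free_next : ∀ k ∈ [(0 : ZMod 6), 1, 4], ∀ e : ZMod 6,
    ¬ ((Cell.up 0 0).move (probe k).1 (probe k).2).inMove Cell.inTop e.val
      (center (dir (k + 1))) := by
  decide +kernel

lemma gridPlacement_eq_tile {j : ℕ} (hj : j < 6) (x : ℤ × ℤ) :
    gridPlacement j (center x) = tile (j : ZMod 6) x := by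
  rw [tile, ZMod.val_natCast_of_lt hj]

lemma mem_gridPlacement_zero {c : Cell} : c ∈ topCells.image (Cell.move 0 0) ↔ c.inTop := by
  rw [show Cell.move 0 0 = id from funext move_zero_zero, Finset.image_id, mem_topCells]

/-- Next to a tile at the origin there is a lattice tile at each side with a dent, with a bump that
fills the dent. -/
lemma IsTiling.dent_neighbor (hT : IsTiling T) (h0 : tile 0 0 ∈ T) {k : ZMod 6}
    (hk : k ∈ [(2 : ZMod 6), 3, 5]) : ∃ e, tile e (dir k) ∈ T ∧ isOut e (k + 3) := by
  rw [tile_zero_zero] at h0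
  obtain ⟨p1, p2⟩ := dent_probe k hk
  obtain ⟨j, hj, p, hmem, c, hc, hcm⟩ := hT.fill (j := (probe k).1) (p := (probe k).2)
    (hasCell_of_mem h0 (mem_gridPlacement_zero.2 p1))
    (hasCell_of_mem h0 (mem_gridPlacement_zero.2 p2))
  have hoff : offset (Cell.rotate^[j] c) ((Cell.up 0 0).move (probe k).1 (probe k).2) = p := by
    rw [← hcm]; exact offset_shift _ _
  have hcheck := dent_check k hk j (List.mem_range.2 hj) c (mem_topList.2 hc)
  simp only [hoff] at hcheck
  rcases hcheck hcm with rfl | ⟨b, hb, hbt⟩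
  · rw [gridPlacement_eq_tile hj] at hmem
    refine ⟨_, hmem, dent_filled k hk _ ?_⟩
    rw [← mem_tile_top, ZMod.val_natCast_of_lt hj]
    exact Finset.mem_image.2 ⟨c, hc, hcm⟩
  · have hne := hT.not_mem_both hmem h0
      (Finset.mem_image_of_mem _ (mem_topList.1 hb)) (mem_gridPlacement_zero.2 hbt)
    refine absurd ?_ (probe_free k)
    rw [← hcm, gridPlacement_injective_aux hne c, move_zero_zero]
    exact mem_topCells.1 hc

/-- Next to a tile at the origin there is a lattice tile at a side with a bump, provided that there
is one at the following side. -/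
lemma IsTiling.bump_neighbor (hT : IsTiling T) (h0 : tile 0 0 ∈ T) {k : ZMod 6}
    (hk : k ∈ [(0 : ZMod 6), 1, 4]) (hnext : ∃ e, tile e (dir (k + 1)) ∈ T) :
    ∃ e, tile e (dir k) ∈ T := by
  rw [tile_zero_zero] at h0
  obtain ⟨e, he⟩ := hnext
  have core : ∀ {c : Cell}, (c.shift (-center (dir (k + 1)))).inCore →
      c ∈ topCells.image (Cell.move e.val (center (dir (k + 1)))) := by
    intro c h
    rw [mem_tile_top]
    have hbox : c.shift (-center (dir (k + 1))) ∈ box :=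
      mem_box_of_inHex (Bool.and_eq_true_iff.1 h).1
    have := core_check e.val (List.mem_range.2 (val_lt e)) _ hbox h
    rw [← Cell.inMove_shift _ _ _ (center (dir (k + 1)))] at this
    simpa [Cell.shift_shift] using this
  obtain ⟨p1, p2⟩ := bump_probe k hk
  obtain ⟨j, hj, p, hmem, c, hc, hcm⟩ := hT.fill (j := (probe k).1) (p := (probe k).2)
    (hasCell_of_mem h0 (mem_gridPlacement_zero.2 p1)) (hasCell_of_mem he (core p2))
  have hoff : offset (Cell.rotate^[j] c) ((Cell.up 0 0).move (probe k).1 (probe k).2) = p := by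
    rw [← hcm]; exact offset_shift _ _
  have hcheck := bump_check k hk j (List.mem_range.2 hj) c (mem_topList.2 hc)
  simp only [hoff] at hcheck
  rcases hcheck hcm with rfl | ⟨b, hb, hbt⟩ | ⟨b, hb, hbt⟩
  · exact ⟨_, gridPlacement_eq_tile hj _ ▸ hmem⟩
  · have hne := hT.not_mem_both hmem h0
      (Finset.mem_image_of_mem _ (mem_topList.1 hb)) (mem_gridPlacement_zero.2 hbt)
    refine absurd ?_ (probe_free k)
    rw [← hcm, gridPlacement_injective_aux hne c, move_zero_zero]
    exact mem_topCells.1 hc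
  · have hne := hT.not_mem_both hmem he
      (Finset.mem_image_of_mem _ (mem_topList.1 hb)) (core hbt)
    refine absurd ?_ (probe_free_next k hk e)
    rw [← hcm, gridPlacement_injective_aux hne c, ← mem_tile_top]
    exact Finset.mem_image_of_mem _ hc

lemma IsTiling.neighbor_zero (hT : IsTiling T) (h0 : tile 0 0 ∈ T) (k : ZMod 6) :
    ∃ e, tile e (dir k) ∈ T ∧ (isOut 0 k = false → isOut e (k + 3)) := by
  have hd : ∀ k ∈ [(2 : ZMod 6), 3, 5], ∃ e, tile e (dir k) ∈ T := fun k hk =>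
    (hT.dent_neighbor h0 hk).imp fun _ h => h.1
  have h1 := hT.bump_neighbor h0 (k := 1) (by decide) (hd 2 (by decide))
  have h0' := hT.bump_neighbor h0 (k := 0) (by decide) h1
  have h4 := hT.bump_neighbor h0 (k := 4) (by decide) (hd 5 (by decide))
  have hk : k ∈ [(2 : ZMod 6), 3, 5] ∨ k = 0 ∨ k = 1 ∨ k = 4 := by revert k; decide
  rcases hk with hk | rfl | rfl | rfl
  · exact (hT.dent_neighbor h0 hk).imp fun e h => ⟨h.1, fun _ => h.2⟩
  · exact h0'.imp fun e h => ⟨h, fun h => absurd h (by decide)⟩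
  · exact h1.imp fun e h => ⟨h, fun h => absurd h (by decide)⟩
  · exact h4.imp fun e h => ⟨h, fun h => absurd h (by decide)⟩

lemma omegaCircle_pow_val_add (a b : ZMod 6) :
    omegaCircle ^ a.val * omegaCircle ^ b.val = omegaCircle ^ (a + b).val := by
  rw [ZMod.val_add, omegaCircle_pow_mod, pow_add]

lemma omega_pow_mul_center_dir (j : ℕ) (k : ZMod 6) :
    omega ^ j * gridPoint (center (dir k)).1 (center (dir k)).2 =
      gridPoint (center (dir (k + j))).1 (center (dir (k + j))).2 := by
  have key : ∀ k : ZMod 6, center (dir (k + 1)) =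
      (-(center (dir k)).2, (center (dir k)).1 + (center (dir k)).2) := by decide
  induction j with
  | zero => simp
  | succ j ih =>
    rw [pow_succ', mul_assoc, ih, omega_mul_gridPoint, Nat.cast_succ, ← add_assoc, key]

lemma tile_comp (e e' k : ZMod 6) (x : ℤ × ℤ) :
    (tile e x).comp (tile e' (dir k)) = tile (e + e') (x + dir (k + e)) := by
  ext1
  · exact omegaCircle_pow_val_add e e'
  · simp only [tile, gridPlacement, Placement.comp, Circle.coe_pow, coe_omegaCircle]
    rw [omega_pow_mul_center_dir, ZMod.natCast_zmod_val, center_add]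
    apply ext_coord <;> simp [add_comm]

lemma tile_comp_zero (e : ZMod 6) (x : ℤ × ℤ) : (tile e x).comp (tile 0 0) = tile e x := by
  ext1
  · simp [tile, gridPlacement, Placement.comp]
  · simp [tile, gridPlacement, Placement.comp, center, gridPoint]

lemma IsTiling.neighbor (hT : IsTiling T) {e : ZMod 6} {x : ℤ × ℤ} (h : tile e x ∈ T)
    (k : ZMod 6) : ∃ e', tile e' (x + dir k) ∈ T ∧ (isOut e k = false → isOut e' (k + 3)) := by
  have h0 : tile 0 0 ∈ (tile e x).inv.comp '' T :=
    ⟨tile e x, h, by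
      have := Placement.inv_comp (tile e x) (tile 0 0); rwa [tile_comp_zero] at this⟩
  obtain ⟨e', ⟨y, hy, hye⟩, ho⟩ := (hT.image_comp (tile e x).inv).neighbor_zero h0 (k - e)
  obtain rfl : y = tile (e + e') (x + dir k) := by
    rw [← Placement.comp_inv (tile e x) y, hye, tile_comp, sub_add_cancel]
  refine ⟨_, hy, fun hk => ?_⟩
  have key : ∀ e e' k : ZMod 6, isOut e k = false → (isOut 0 (k - e) = false →
      isOut e' (k - e + 3)) → isOut (e + e') (k + 3) := by decide
  exact key e e' k hk ho

lemma IsTiling.exists_tile (hT : IsTiling T) (h0 : tile 0 0 ∈ T) (x : ℤ × ℤ) :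
    ∃ e, tile e x ∈ T := by
  have nat : ∀ (k : ZMod 6) (n : ℕ) (x : ℤ × ℤ), (∃ e, tile e x ∈ T) →
      ∃ e, tile e (x + n • dir k) ∈ T := by
    intro k n x hx
    induction n with
    | zero => simpa using hx
    | succ n ih =>
      obtain ⟨e, he⟩ := ih
      obtain ⟨e', he', -⟩ := hT.neighbor he k
      exact ⟨e', by rwa [succ_nsmul, ← add_assoc]⟩
  have int : ∀ (k : ZMod 6) (n : ℤ) (x : ℤ × ℤ), (∃ e, tile e x ∈ T) →
      ∃ e, tile e (x + n • dir k) ∈ T := by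
    intro k n x hx
    obtain ⟨m, rfl | rfl⟩ := n.eq_nat_or_neg
    · simpa using nat k m x hx
    · simpa [dir_add_three] using nat (k + 3) m x hx
  have := int 1 x.2 _ (int 0 x.1 0 ⟨0, h0⟩)
  convert this using 3
  ext <;> simp

lemma tile_shift (e : ZMod 6) (x : ℤ × ℤ) :
    (tile e x).shift = gridPoint (center x).1 (center x).2 := rfl

lemma tile_injective {e e' : ZMod 6} {x x' : ℤ × ℤ} (h : tile e x = tile e' x') :
    e = e' ∧ x = x' := by
  have hs := congrArg Placement.shift h
  rw [tile_shift, tile_shift] at hs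
  have h1 := congrArg ca hs
  have h2 := congrArg cb hs
  simp only [ca_gridPoint, cb_gridPoint, Int.cast_inj, center] at h1 h2
  obtain rfl : x = x' := by ext <;> omega
  have hm := gridPlacement_injective_aux h (.up 0 0)
  have key : ∀ e e' : ZMod 6, Cell.rotate^[e.val] (.up 0 0) = Cell.rotate^[e'.val] (.up 0 0) →
      e = e' := by decide
  refine ⟨key _ _ ?_, rfl⟩
  have := congrArg (Cell.shift (-center x)) hm
  simpa [Cell.move, Cell.shift_shift] using this

lemma IsTiling.tile_unique (hT : IsTiling T) {e e' : ZMod 6} {x : ℤ × ℤ} (h : tile e x ∈ T)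
    (h' : tile e' x ∈ T) : e = e' := by
  by_contra hne
  have := hT.le_dist h h' fun heq => hne (tile_injective heq).1
  rw [tile_shift, tile_shift, dist_self] at this
  norm_num at this

/-- In the lattice cells of a tiling, bumps meet dents. -/
lemma IsTiling.isOut_ne (hT : IsTiling T) {d : ℤ × ℤ → ZMod 6} (hd : ∀ x, tile (d x) x ∈ T)
    (x : ℤ × ℤ) (k : ZMod 6) : isOut (d x) k ≠ isOut (d (x + dir k)) (k + 3) := by
  intro heq
  rcases Bool.eq_false_or_eq_true (isOut (d x) k) with h | h
  · have hno : ¬ ∀ c ∈ box, ¬ (c.inMove Cell.inTop (d x).val 0 ∧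
        c.inMove Cell.inTop (d (x + dir k)).val (center (dir k))) := by
      rw [top_top_check]; push Not; exact ⟨h, heq ▸ h⟩
    push Not at hno
    obtain ⟨c, -, h1, h2⟩ := hno
    rw [← Cell.inMove_shift _ _ _ (center x)] at h1 h2
    rw [zero_add] at h1
    rw [← center_add, add_comm (dir k) x] at h2
    have := hT.not_mem_both (hd x) (hd (x + dir k)) (mem_tile_top.2 h1) (mem_tile_top.2 h2)
    have := (tile_injective this).2
    have hne : ∀ k, dir k ≠ 0 := by decide
    exact hne k (by simpa using this.symm)
  · obtain ⟨e, he, ho⟩ := hT.neighbor (hd x) k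
    rw [hT.tile_unique he (hd _)] at ho
    rw [← heq, h] at ho
    simp at ho

lemma not_disjoint_iff_exists_shift {f f' : Cell → Bool}
    (hf : ∀ c, f c → c.inTop ∨ c.inBottom) {j j' : ℕ} (hj : j < 6) (x y : ℤ × ℤ) :
    (∃ c : Cell, c.inMove f j (center x) ∧ c.inMove f' j' (center (x + y))) ↔
      ∃ c : Cell, c ∈ box ∧ c.inMove f j 0 ∧ c.inMove f' j' (center y) := by
  constructor
  · rintro ⟨c, h1, h2⟩
    have e : c = (c.shift (-center x)).shift (center x) := by simp [Cell.shift_shift]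
    have k1 : (c.shift (-center x)).inMove f j 0 := by
      rw [← Cell.inMove_shift _ _ _ (center x), ← e, zero_add]; exact h1
    refine ⟨c.shift (-center x), mem_box_of_inMove hf hj k1, k1, ?_⟩
    rw [← Cell.inMove_shift _ _ _ (center x), ← e, ← center_add, add_comm y]; exact h2
  · rintro ⟨c, -, h1, h2⟩
    rw [← Cell.inMove_shift _ _ _ (center x)] at h1 h2
    rw [zero_add] at h1
    rw [← center_add, add_comm y x] at h2
    exact ⟨_, h1, h2⟩

lemma obstructs_iff_exists {e e' : ZMod 6} {x y : ℤ × ℤ} :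
    Obstructs (tile e' (x + y)) (tile e x) ↔
      ∃ c ∈ box, c.inMove Cell.inBottom e.val 0 ∧ c.inMove Cell.inTop e'.val (center y) := by
  rw [← not_disjoint_iff_exists_shift (fun _ h => .inr h) (val_lt e), Obstructs,
    ← Set.not_disjoint_iff_nonempty_inter, tile, tile, gridPlacement_top, gridPlacement_bottom,
    interior_region_disjoint, Finset.not_disjoint_iff]
  simp only [mem_tile_top, mem_tile_bottom]
  exact exists_congr fun c => and_comm

/-- Tiles in front of each other along the arrows have to be laid in this order, which excludes
cycles. -/
lemma IsTiling.acyclic (hT : IsTiling T) {d : ℤ × ℤ → ZMod 6} (hd : ∀ x, tile (d x) x ∈ T)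
    (x : ℤ × ℤ) : ¬ TransGen (StepOn Set.univ d) x x := by
  classical
  intro hcyc
  set next : ℤ × ℤ → ℤ × ℤ := fun x => x + dir (d x) with hnext
  obtain ⟨n, hn, hx⟩ : ∃ n, 0 < n ∧ next^[n] x = x := by
    have : ∀ y, TransGen (StepOn Set.univ d) x y → ∃ n, 0 < n ∧ next^[n] x = y := by
      intro y hy
      induction hy with
      | single h => exact ⟨1, one_pos, h.2.2.symm⟩
      | tail _ h ih =>
        obtain ⟨n, -, hn⟩ := ih
        exact ⟨n + 1, n.succ_pos, by rw [Function.iterate_succ_apply', hn]; exact h.2.2.symm⟩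
    exact this x hcyc
  set P : ℕ → Placement := fun i => tile (d (next^[i] x)) (next^[i] x) with hP
  obtain ⟨l, hnd, hmem, hpw⟩ := hT.laid ((Finset.range (n + 1)).image P) (by
    intro y hy
    obtain ⟨i, -, rfl⟩ := Finset.mem_image.1 (Finset.mem_coe.1 hy)
    exact hd _)
  have hPl : ∀ i ≤ n, P i ∈ l := fun i hi => (hmem _).2
    (Finset.mem_image_of_mem _ (Finset.mem_range.2 (by omega)))
  have hobs : ∀ i, Obstructs (P (i + 1)) (P i) := by
    intro i
    have hs : next^[i + 1] x = next^[i] x + dir (d (next^[i] x)) := by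
      rw [Function.iterate_succ_apply']
    simp only [hP]
    rw [hs, obstructs_iff_exists, bottom_top_check _ _ _ (hT.isOut_ne hd _ _)]
  have hlt : ∀ i < n, l.idxOf (P i) < l.idxOf (P (i + 1)) := by
    intro i hi
    have hi1 := List.idxOf_lt_length_iff.2 (hPl i hi.le)
    have hi2 := List.idxOf_lt_length_iff.2 (hPl (i + 1) hi)
    rcases lt_trichotomy (l.idxOf (P i)) (l.idxOf (P (i + 1))) with h | h | h
    · exact h
    · have heq : P i = P (i + 1) := by
        rw [← List.getElem_idxOf hi1, ← List.getElem_idxOf hi2]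
        simp only [h]
      have := (tile_injective heq).2
      rw [Function.iterate_succ_apply'] at this
      have hne : ∀ k, dir k ≠ 0 := by decide
      exact absurd (by simpa [hnext] using this.symm) (hne (d (next^[i] x)))
    · have := List.pairwise_iff_getElem.1 hpw _ _ hi2 hi1 h
      rw [List.getElem_idxOf, List.getElem_idxOf] at this
      exact absurd (hobs i) this
  have hle : ∀ i ≤ n, l.idxOf (P 0) + i ≤ l.idxOf (P i) := by
    intro i
    induction i with
    | zero => simp
    | succ i ih => intro hi; have := ih (by omega); have := hlt i (by omega); omega
  have h0 : P n = P 0 := by simp only [hP, hx, Function.iterate_zero, id]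
  have := hle n le_rfl
  rw [h0] at this
  omega

lemma IsTiling.validOn (hT : IsTiling T) {d : ℤ × ℤ → ZMod 6} (hd : ∀ x, tile (d x) x ∈ T) :
    ValidOn Set.univ d :=
  ⟨fun x _ k _ => hT.isOut_ne hd x k, hT.acyclic hd⟩

/-! ### Tilings have no periods -/

/-- Every point has distance at most `3` from the centre of some hexagon of the lattice. -/
lemma exists_dist_center_le (z : ℂ) :
    ∃ x : ℤ × ℤ, dist z (gridPoint (center x).1 (center x).2) ≤ 3 := by
  by_contra! hfar
  have key : ∀ i j : ℤ, 1 / 3 < ((2 * ca z + cb z) / 9 - i) ^ 2 +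
      ((2 * ca z + cb z) / 9 - i) * ((cb z - ca z) / 9 - j) + ((cb z - ca z) / 9 - j) ^ 2 := by
    intro i j
    have h := hfar (i, j)
    have h2 := norm_sq_eq (z - gridPoint (center (i, j)).1 (center (i, j)).2)
    rw [dist_eq_norm] at h
    simp only [map_sub, ca_gridPoint, cb_gridPoint, center] at h2
    push_cast at h2
    have h9 : (9 : ℝ) < ‖z - gridPoint (center (i, j)).1 (center (i, j)).2‖ ^ 2 := by
      nlinarith
    simp only [center] at h9
    rw [h2] at h9
    nlinarith
  set α := (2 * ca z + cb z) / 9 with hα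
  set β := (cb z - ca z) / 9 with hβ
  have a1 := Int.floor_le α
  have a2 := (Int.lt_floor_add_one α).le
  have b1 := Int.floor_le β
  have b2 := (Int.lt_floor_add_one β).le
  have k10 := key (⌊α⌋ + 1) ⌊β⌋
  have k01 := key ⌊α⌋ (⌊β⌋ + 1)
  -- a weighted mean of the squared distances to the vertices of a triangle containing the point
  rcases le_total ((α - ⌊α⌋) + (β - ⌊β⌋)) 1 with h | h
  · have k00 := key ⌊α⌋ ⌊β⌋
    push_cast at k10 k01
    generalize (⌊α⌋ : ℝ) = I at *
    generalize (⌊β⌋ : ℝ) = J at *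
    nlinarith [mul_nonneg (sub_nonneg.2 a1) (sub_nonneg.2 k10.le),
      mul_nonneg (sub_nonneg.2 b1) (sub_nonneg.2 k01.le),
      mul_nonneg (sub_nonneg.2 h) (sub_nonneg.2 k00.le),
      sq_nonneg (α - I - 1 / 3), sq_nonneg (β - J - 1 / 3), sq_nonneg (α - I + (β - J) - 2 / 3)]
  · have k11 := key (⌊α⌋ + 1) (⌊β⌋ + 1)
    push_cast at k10 k01 k11
    generalize (⌊α⌋ : ℝ) = I at *
    generalize (⌊β⌋ : ℝ) = J at *
    nlinarith [mul_nonneg (sub_nonneg.2 a2) (sub_nonneg.2 k01.le),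
      mul_nonneg (sub_nonneg.2 b2) (sub_nonneg.2 k10.le),
      mul_nonneg (sub_nonneg.2 h) (sub_nonneg.2 k11.le),
      sq_nonneg (α - I - 2 / 3), sq_nonneg (β - J - 2 / 3), sq_nonneg (α - I + (β - J) - 4 / 3)]

lemma IsTiling.eq_tile (hT : IsTiling T) {d : ℤ × ℤ → ZMod 6} (hd : ∀ x, tile (d x) x ∈ T)
    {y : Placement} (hy : y ∈ T) : ∃ x, y = tile (d x) x := by
  obtain ⟨x, hx⟩ := exists_dist_center_le y.shift
  refine ⟨x, ?_⟩
  by_contra hne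
  have := hT.le_dist hy (hd x) hne
  rw [tile_shift] at this
  linarith

theorem IsTiling.not_isPeriod (hT : IsTiling T) {p : ℂ} (hp : p ≠ 0) : ¬ IsPeriod T p := by
  intro hper
  have hz : (0 : ℂ) ∈ ⋃ x ∈ T, x.top := hT.cover ▸ Set.mem_univ 0
  obtain ⟨x0, hx0, -⟩ := Set.mem_iUnion₂.1 hz
  have hT' := hT.image_comp x0.inv
  have h0 : tile 0 0 ∈ x0.inv.comp '' T := by
    refine ⟨x0, hx0, ?_⟩
    have : x0.comp (tile 0 0) = x0 := by
      ext1 <;> simp [tile, gridPlacement, Placement.comp, center, gridPoint]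
    have h := Placement.inv_comp x0 (tile 0 0)
    rwa [this] at h
  choose d hd using hT'.exists_tile h0
  set q : ℂ := (x0.rot : ℂ)⁻¹ * p with hq
  have hq0 : q ≠ 0 := mul_ne_zero (inv_ne_zero (rot_ne_zero x0)) hp
  have htr : ∀ y ∈ x0.inv.comp '' T, y.translate q ∈ x0.inv.comp '' T := by
    rintro _ ⟨x, hx, rfl⟩
    refine ⟨x.translate p, hper ▸ Set.mem_image_of_mem _ hx, ?_⟩
    ext1
    · rfl
    · simp only [Placement.comp, Placement.translate, Placement.inv, Circle.coe_inv, hq]; ring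
  obtain ⟨w, hw⟩ := hT'.eq_tile hd (htr _ (hd 0))
  have hqw : q = gridPoint (center w).1 (center w).2 := by
    have := congrArg Placement.shift hw
    simpa [tile_shift, Placement.translate, center, gridPoint] using this
  have hdw : ∀ x, d (x + w) = d x := by
    intro x
    have h1 := htr _ (hd x)
    have h2 : (tile (d x) x).translate q = tile (d x) (x + w) := by
      ext1
      · rfl
      · simp only [Placement.translate, tile_shift, hqw]
        apply ext_coord <;> simp [center_add]
    rw [h2] at h1
    exact hT'.tile_unique (hd _) h1
  have hw0 := (hT'.validOn hd).period_eq_zero hdw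
  rw [hw0] at hqw
  exact hq0 (by simpa [center, gridPoint] using hqw)

/-! ### A self-similar orientation pattern -/

/-- The orientations of a tiling, defined by doubling: the pattern on the even cells `2 y` is a copy
of the whole pattern, and the odd cell `2 y + dir a` between `2 y` and `2 (y + dir a)` has its arrow
on the axis of `dir a`, with a bump towards `2 (y + dir a)` if `y` has one towards `y + dir a`.
The values at `0`, `-dir 0`, `-dir 1` and `-dir 2`, for which this recursion does not descend, are
chosen consistently. -/
def pattern (i j : ℤ) : ZMod 6 :=
  if i = 0 ∧ j = 0 then 0
  else if i = -1 ∧ j = 0 then 0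
  else if i = 0 ∧ j = -1 then 4
  else if i = 1 ∧ j = -1 then 2
  else if i % 2 = 0 then
    if j % 2 = 0 then pattern (i / 2) (j / 2)
    else if isOut (pattern (i / 2) ((j - 1) / 2)) 1 then 1 else 4
  else if j % 2 = 0 then
    if isOut (pattern ((i - 1) / 2) (j / 2)) 0 then 0 else 3
  else if isOut (pattern ((i + 1) / 2) ((j - 1) / 2)) 2 then 2 else 5
termination_by i.natAbs + j.natAbs
decreasing_by all_goals omega

/-- The pattern as a function of the lattice cell. -/
def orient (x : ℤ × ℤ) : ZMod 6 := pattern x.1 x.2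

lemma orient_base : orient 0 = 0 ∧ orient (-1, 0) = 0 ∧ orient (0, -1) = 4 ∧
    orient (1, -1) = 2 := by
  refine ⟨?_, ?_, ?_, ?_⟩ <;> simp only [orient] <;> rw [pattern] <;> simp

lemma orient_two_mul (y : ℤ × ℤ) : orient (2 * y.1, 2 * y.2) = orient y := by
  by_cases h : y.1 = 0 ∧ y.2 = 0
  · obtain ⟨i, j⟩ := y
    obtain ⟨rfl, rfl⟩ := h
    simp
  · simp only [orient]
    rw [pattern, if_neg (by omega), if_neg (by omega), if_neg (by omega), if_neg (by omega),
      if_pos (by omega), if_pos (by omega)]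
    congr 1 <;> omega

lemma orient_odd_zero (y : ℤ × ℤ) : orient (2 * y.1 + 1, 2 * y.2) =
    if isOut (orient y) 0 then 0 else 3 := by
  by_cases h : y = (-1, 0)
  · subst h
    have := orient_base.2.1
    simp [this, isOut]
  · have h' : ¬ (y.1 = -1 ∧ y.2 = 0) := fun h' => h (Prod.ext h'.1 h'.2)
    simp only [orient]
    rw [pattern, if_neg (by omega), if_neg (by omega), if_neg (by omega), if_neg (by omega),
      if_neg (by omega), if_pos (by omega), show (2 * y.1 + 1 - 1) / 2 = y.1 by omega,
      show 2 * y.2 / 2 = y.2 by omega]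
    rfl

lemma orient_odd_one (y : ℤ × ℤ) : orient (2 * y.1, 2 * y.2 + 1) =
    if isOut (orient y) 1 then 1 else 4 := by
  by_cases h : y = (0, -1)
  · subst h
    have := orient_base.2.2.1
    have h2 : isOut 4 1 = false := by decide
    simp [this, h2]
  · have h' : ¬ (y.1 = 0 ∧ y.2 = -1) := fun h' => h (Prod.ext h'.1 h'.2)
    simp only [orient]
    rw [pattern, if_neg (by omega), if_neg (by omega), if_neg (by omega), if_neg (by omega),
      if_pos (by omega), if_neg (by omega), show 2 * y.1 / 2 = y.1 by omega,
      show (2 * y.2 + 1 - 1) / 2 = y.2 by omega]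
    rfl

lemma orient_odd_two (y : ℤ × ℤ) : orient (2 * y.1 - 1, 2 * y.2 + 1) =
    if isOut (orient y) 2 then 2 else 5 := by
  by_cases h : y = (1, -1)
  · subst h
    have := orient_base.2.2.2
    simp [this, isOut]
  · have h' : ¬ (y.1 = 1 ∧ y.2 = -1) := fun h' => h (Prod.ext h'.1 h'.2)
    simp only [orient]
    rw [pattern, if_neg (by omega), if_neg (by omega), if_neg (by omega), if_neg (by omega),
      if_neg (by omega), if_neg (by omega), show (2 * y.1 - 1 + 1) / 2 = y.1 by omega,
      show (2 * y.2 + 1 - 1) / 2 = y.2 by omega]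
    rfl

lemma orient_double (y : ℤ × ℤ) : orient (y + y) = orient y := by
  rw [← orient_two_mul y]; congr 1; ext <;> simp <;> ring

lemma orient_odd (y : ℤ × ℤ) {a : ZMod 6} (ha : a ∈ [(0 : ZMod 6), 1, 2]) :
    orient (y + y + dir a) = if isOut (orient y) a then a else a + 3 := by
  simp only [List.mem_cons, List.not_mem_nil, or_false] at ha
  rcases ha with rfl | rfl | rfl
  · rw [← (show (2 * y.1 + 1, 2 * y.2) = y + y + dir 0 by ext <;> simp <;> ring)]
    exact orient_odd_zero y
  · rw [← (show (2 * y.1, 2 * y.2 + 1) = y + y + dir 1 by ext <;> simp <;> ring)]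
    exact orient_odd_one y
  · rw [← (show (2 * y.1 - 1, 2 * y.2 + 1) = y + y + dir 2 by ext <;> simp <;> ring)]
    exact orient_odd_two y

lemma orient_matched_of_mem (x : ℤ × ℤ) {k : ZMod 6} (hk : k ∈ [(0 : ZMod 6), 1, 2]) :
    isOut (orient x) k ≠ isOut (orient (x + dir k)) (k + 3) := by
  obtain ⟨y, rfl | ⟨a, ha, rfl⟩⟩ := exists_eq_double_or x
  · rw [orient_double, orient_odd y hk]
    generalize orient y = e
    revert e k
    decide
  by_cases hak : a = k
  · subst hak
    rw [show y + y + dir a + dir a = (y + dir a) + (y + dir a) by abel, orient_double,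
      orient_odd y ha]
    have hs : isOut (if isOut (orient y) a then a else a + 3) a = isOut (orient y) a := by
      generalize orient y = e
      revert e a
      decide
    rw [hs]
    by_cases hy : y + dir a = 0
    · obtain rfl := eq_neg_of_add_eq_zero_left hy
      rw [neg_add_cancel]
      obtain ⟨h0, h1, h2, h3⟩ := orient_base
      simp only [List.mem_cons, List.not_mem_nil, or_false] at ha
      rw [h0]
      rcases ha with rfl | rfl | rfl
      · rw [show -dir 0 = (-1, 0) by decide, h1]; decide
      · rw [show -dir 1 = (0, -1) by decide, h2]; decide
      · rw [show -dir 2 = (1, -1) by decide, h3]; decide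
    · have hlt : y.1.natAbs + y.2.natAbs <
          (y + y + dir a).1.natAbs + (y + y + dir a).2.natAbs := by
        have hy' : ¬ ((y + dir a).1 = 0 ∧ (y + dir a).2 = 0) :=
          fun h => hy (Prod.ext h.1 h.2)
        simp only [List.mem_cons, List.not_mem_nil, or_false] at ha
        rcases ha with rfl | rfl | rfl <;> simp at hy' ⊢ <;> omega
      exact orient_matched_of_mem y ha
  · -- both cells are odd, and the three axes involved are different
    have hb : ∃ b ∈ [(0 : ZMod 6), 1, 2], b ≠ a ∧ b ≠ k ∧ ∃ z : ℤ × ℤ,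
        y + y + dir a + dir k = z + z + dir b := by
      have key : ∀ a ∈ [(0 : ZMod 6), 1, 2], ∀ k ∈ [(0 : ZMod 6), 1, 2], a ≠ k →
          ∃ b ∈ [(0 : ZMod 6), 1, 2], b ≠ a ∧ b ≠ k ∧ ∃ l ∈ [0, dir 0, dir 2],
            dir a + dir k = l + l + dir b := by decide
      obtain ⟨b, hb, h1, h2, l, -, hl⟩ := key a ha k hk hak
      exact ⟨b, hb, h1, h2, y + l, by rw [add_assoc, hl]; abel⟩
    obtain ⟨b, hb, hba, hbk, z, hz⟩ := hb
    rw [hz, orient_odd y ha, orient_odd z hb]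
    generalize orient y = e
    generalize orient z = e'
    have key : ∀ a ∈ [(0 : ZMod 6), 1, 2], ∀ b ∈ [(0 : ZMod 6), 1, 2],
        ∀ k ∈ [(0 : ZMod 6), 1, 2], a ≠ k → b ≠ a → b ≠ k → ∀ s t : Bool,
        isOut (if s then a else a + 3) k ≠ isOut (if t then b else b + 3) (k + 3) := by decide
    exact key a ha b hb k hk hak hba hbk _ _
termination_by x.1.natAbs + x.2.natAbs

/-- In the pattern, bumps meet dents. -/
lemma orient_matched (x : ℤ × ℤ) (k : ZMod 6) :
    isOut (orient x) k ≠ isOut (orient (x + dir k)) (k + 3) := by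
  have h : k ∈ [(0 : ZMod 6), 1, 2] ∨ k + 3 ∈ [(0 : ZMod 6), 1, 2] := by revert k; decide
  rcases h with h | h
  · exact orient_matched_of_mem x h
  · have := orient_matched_of_mem (x + dir k) h
    rw [add_dir_add_three, show k + 3 + 3 = k by clear h this; revert k; decide] at this
    exact this.symm

lemma orient_double_add (y : ℤ × ℤ) (k : ZMod 6) :
    orient (y + y + dir k) = if isOut (orient y) k then k else k + 3 := by
  have h : k ∈ [(0 : ZMod 6), 1, 2] ∨ k + 3 ∈ [(0 : ZMod 6), 1, 2] := by revert k; decide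
  rcases h with h | h
  · exact orient_odd y h
  · have hm := orient_matched y k
    have e : y + y + dir k = (y + dir k) + (y + dir k) + dir (k + 3) := by
      rw [dir_add_three]; abel
    rw [e, orient_odd _ h]
    clear e
    revert hm h
    generalize orient (y + dir k) = e'
    generalize orient y = e
    revert e e' k
    decide

/-- From a cell, step to the neighbour in front of its arrow. -/
def next (x : ℤ × ℤ) : ℤ × ℤ := x + dir (orient x)

lemma next_double (y : ℤ × ℤ) : next (y + y) = y + y + dir (orient y) := by
  rw [next, orient_double]

lemma next_next_double (y : ℤ × ℤ) : next (next (y + y)) = next y + next y := by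
  have h : ∀ e : ZMod 6, isOut e e := by decide
  rw [next_double, next, orient_double_add, if_pos (h _), next]
  abel

lemma next_iterate_double (m : ℕ) (y : ℤ × ℤ) :
    next^[2 * m] (y + y) = next^[m] y + next^[m] y := by
  induction m generalizing y with
  | zero => rfl
  | succ m ih =>
    rw [Nat.mul_succ, Function.iterate_add_apply, Function.iterate_succ_apply]
    exact (congrArg _ (next_next_double y)).trans (ih (next y))

lemma double_add_dir_ne (y z : ℤ × ℤ) (k : ZMod 6) : y + y + dir k ≠ z + z := by
  intro h
  have h1 := congrArg Prod.fst h
  have h2 := congrArg Prod.snd h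
  have key : ∀ k, (dir k).1 % 2 = 1 ∨ (dir k).2 % 2 = 1 := by decide
  have := key k
  simp only [Prod.fst_add, Prod.snd_add] at h1 h2
  omega

/-- Arrows never lead around a cycle: two steps from an even cell `2 y` amount to one step from `y`,
so that a cycle would give rise to one of half its length. -/
lemma next_iterate_ne {n : ℕ} (hn : 0 < n) (x : ℤ × ℤ) : next^[n] x ≠ x := by
  induction n using Nat.strong_induction_on generalizing x with
  | _ n ih =>
    have even : ∀ y, next^[n] (y + y) ≠ y + y := by
      intro y h
      obtain ⟨m, rfl | rfl⟩ := n.even_or_odd'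
      · rw [next_iterate_double] at h
        refine ih m (by omega) (by omega) y ?_
        have h1 := congrArg Prod.fst h
        have h2 := congrArg Prod.snd h
        simp only [Prod.fst_add, Prod.snd_add] at h1 h2
        ext <;> omega
      · rw [Function.iterate_succ_apply', next_iterate_double, next_double] at h
        exact double_add_dir_ne _ _ _ h
    intro h
    obtain ⟨y, rfl | ⟨a, -, rfl⟩⟩ := exists_eq_double_or x
    · exact even y h
    · have hx : ∃ z, next (y + y + dir a) = z + z := by
        rw [next, orient_double_add]
        split_ifs
        · exact ⟨y + dir a, by abel⟩
        · exact ⟨y, by rw [dir_add_three]; abel⟩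
      obtain ⟨z, hz⟩ := hx
      refine even z ?_
      rw [← hz, ← Function.iterate_succ_apply, Function.iterate_succ_apply', h]

/-- Finitely many cells can be listed such that each one comes before the cell in front of it. -/
lemma exists_list_next (s : Finset (ℤ × ℤ)) : ∃ l : List (ℤ × ℤ),
    l.Nodup ∧ (∀ x, x ∈ l ↔ x ∈ s) ∧ l.Pairwise fun x y => x ≠ next y := by
  induction s using Finset.strongInduction with
  | H s ih =>
    rcases s.eq_empty_or_nonempty with rfl | ⟨x, hx⟩
    · exact ⟨[], by simp⟩
    -- some cell of `s` has the cell in front of it outside `s`, and it may come last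
    obtain ⟨z, hz, hzn⟩ : ∃ z ∈ s, next z ∉ s := by
      by_contra! hs
      have hit : ∀ n : ℕ, next^[n] x ∈ s := by
        intro n
        induction n with
        | zero => exact hx
        | succ n ihn => rw [Function.iterate_succ_apply']; exact hs _ ihn
      obtain ⟨i, j, hij, he⟩ := Finite.exists_ne_map_eq_of_infinite
        (fun n : ℕ => (⟨next^[n] x, hit n⟩ : s))
      simp only [Subtype.mk.injEq] at he
      wlog hlt : i < j generalizing i j
      · exact this j i hij.symm he.symm (by omega)
      obtain ⟨m, rfl⟩ := Nat.exists_eq_add_of_lt hlt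
      rw [show i + m + 1 = (m + 1) + i by omega, Function.iterate_add_apply] at he
      exact next_iterate_ne m.succ_pos _ he.symm
    obtain ⟨l, hnd, hmem, hpw⟩ := ih _ (Finset.erase_ssubset hz)
    refine ⟨l ++ [z], ?_, fun w => ?_, ?_⟩
    · refine List.nodup_append.2 ⟨hnd, by simp, fun a ha b hb => ?_⟩
      rw [List.mem_singleton] at hb
      exact hb ▸ (Finset.mem_erase.1 ((hmem a).1 ha)).1
    · rw [List.mem_append, hmem, List.mem_singleton, Finset.mem_erase]
      by_cases hw : w = z <;> simp [hw, hz]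
    · refine List.pairwise_append.2 ⟨hpw, by simp, fun a ha b hb => ?_⟩
      rw [List.mem_singleton] at hb
      rintro rfl
      exact hzn (hb ▸ Finset.mem_of_mem_erase ((hmem _).1 ha))

/-! ### The tiling of the pattern -/

lemma bounds_of_mem_box {c : Cell} (h : c ∈ box) :
    -4 ≤ c.corner.1 ∧ c.corner.1 ≤ 4 ∧ -4 ≤ c.corner.2 ∧ c.corner.2 ≤ 4 := by
  have key : ∀ c ∈ box,
      -4 ≤ c.corner.1 ∧ c.corner.1 ≤ 4 ∧ -4 ≤ c.corner.2 ∧ c.corner.2 ≤ 4 := by decide +kernel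
  exact key c h

lemma Cell.corner_shift (c : Cell) (p : ℤ × ℤ) : (c.shift p).corner = c.corner + p := by
  cases c <;> ext <;> simp [Cell.shift, Cell.corner] <;> ring

/-- Lattice tiles that are neither equal nor adjacent have no cell in common in any layers. -/
lemma eq_zero_or_dir_of_common {f f' : Cell → Bool} (hf : f = Cell.inTop ∨ f = Cell.inBottom)
    (hf' : f' = Cell.inTop ∨ f' = Cell.inBottom) {e e' : ZMod 6} {c : Cell} {w : ℤ × ℤ}
    (h : c.inMove f e.val 0) (h' : c.inMove f' e'.val (center w)) : w = 0 ∨ ∃ k, w = dir k := by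
  have hor : ∀ {f : Cell → Bool}, f = Cell.inTop ∨ f = Cell.inBottom →
      ∀ c, f c → c.inTop ∨ c.inBottom := by
    rintro f (rfl | rfl) c h
    exacts [.inl h, .inr h]
  have hb := mem_box_of_inMove (hor hf) (val_lt e) h
  have h0 : (c.shift (-center w)).inMove f' e'.val 0 := by
    rw [← Cell.inMove_shift _ _ _ (center w), zero_add, Cell.shift_shift, neg_add_cancel,
      Cell.shift_zero]
    exact h'
  have hb' := bounds_of_mem_box (mem_box_of_inMove (hor hf') (val_lt e') h0)
  have hb1 := bounds_of_mem_box hb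
  rw [Cell.corner_shift] at hb'
  obtain ⟨i, j⟩ := w
  simp only [center, Prod.fst_add, Prod.snd_add, Prod.fst_neg, Prod.snd_neg] at hb'
  have hi : i ∈ [-3, -2, -1, 0, 1, 2, 3] := by
    simp only [List.mem_cons, List.not_mem_nil]; omega
  have hj : j ∈ [-1, 0, 1] := by
    simp only [List.mem_cons, List.not_mem_nil]; omega
  rcases far_check i hi j hj with h1 | h1 | h1
  · exact .inl h1
  · exact .inr h1
  · refine absurd ⟨e', ?_⟩ (h1 c hb ⟨e, ?_⟩)
    · rcases hf with rfl | rfl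
      exacts [.inl h, .inr h]
    · rcases hf' with rfl | rfl
      exacts [.inl h', .inr h']

/-- Every cell lies in some hexagon of the lattice. -/
lemma exists_shift_inHex (c : Cell) : ∃ x, (c.shift (-center x)).inHex := by
  have key : ∀ r ∈ [(0 : ℤ), 1, 2], ∀ s ∈ [(0 : ℤ), 1, 2, 3, 4, 5, 6, 7, 8],
      (∃ x ∈ [((0 : ℤ), (0 : ℤ)), (0, 1), (1, 0), (1, 1), (2, 1)],
        ((Cell.up r s).shift (-center x)).inHex) ∧
      ∃ x ∈ [((0 : ℤ), (0 : ℤ)), (0, 1), (1, 0), (1, 1), (2, 1)],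
        ((Cell.down r s).shift (-center x)).inHex := by
    decide +kernel
  have red : ∀ m n : ℤ, ∃ r ∈ [(0 : ℤ), 1, 2], ∃ s ∈ [(0 : ℤ), 1, 2, 3, 4, 5, 6, 7, 8],
      ∃ y : ℤ × ℤ, (m, n) = (r, s) + center y := by
    intro m n
    refine ⟨m % 3, ?_, (n - 3 * (m / 3)) % 9, ?_,
      (m / 3 + (n - 3 * (m / 3)) / 9, (n - 3 * (m / 3)) / 9), ?_⟩
    · simp only [List.mem_cons, List.not_mem_nil]; omega
    · simp only [List.mem_cons, List.not_mem_nil]; omega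
    · ext <;> simp only [center, Prod.fst_add, Prod.snd_add] <;> omega
  have done : ∀ (c' : Cell) (y x : ℤ × ℤ), (c'.shift (-center x)).inHex →
      ∃ x, ((c'.shift (center y)).shift (-center x)).inHex := by
    intro c' y x h
    refine ⟨y + x, ?_⟩
    rw [Cell.shift_shift, center_add, neg_add, add_neg_cancel_left]
    exact h
  cases c with
  | up m n =>
    obtain ⟨r, hr, s, hs, y, hy⟩ := red m n
    obtain ⟨x, -, hx⟩ := (key r hr s hs).1
    have := done _ y x hx
    simp only [Prod.ext_iff, Prod.fst_add, Prod.snd_add] at hy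
    rwa [show (Cell.up r s).shift (center y) = .up m n by rw [hy.1, hy.2]; rfl] at this
  | down m n =>
    obtain ⟨r, hr, s, hs, y, hy⟩ := red m n
    obtain ⟨x, -, hx⟩ := (key r hr s hs).2
    have := done _ y x hx
    simp only [Prod.ext_iff, Prod.fst_add, Prod.snd_add] at hy
    rwa [show (Cell.down r s).shift (center y) = .down m n by rw [hy.1, hy.2]; rfl] at this

/-- A cell of the hexagon at the origin that is missing from the tile is filled by the bump of a
neighbour. -/
lemma cover_check : ∀ c ∈ box, c.inHex → ∀ e : ZMod 6, c.inMove Cell.inTop e.val 0 ∨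
    ∃ k, isOut e k = false ∧ ∀ e', isOut e' (k + 3) →
      c.inMove Cell.inTop e'.val (center (dir k)) := by
  decide +kernel

lemma exists_inMove_inTop (c : Cell) : ∃ x, c.inMove Cell.inTop (orient x).val (center x) := by
  obtain ⟨x, hx⟩ := exists_shift_inHex c
  have e : (c.shift (-center x)).shift (center x) = c := by simp [Cell.shift_shift]
  rcases cover_check _ (mem_box_of_inHex hx) hx (orient x) with h | ⟨k, hk, h⟩
  · refine ⟨x, ?_⟩
    rwa [← Cell.inMove_shift _ _ _ (center x), e, zero_add] at h
  · refine ⟨x + dir k, ?_⟩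
    have hm := orient_matched x k
    have := h (orient (x + dir k)) (by rw [hk] at hm; simpa using hm.symm)
    rwa [← Cell.inMove_shift _ _ _ (center x), e, ← center_add, add_comm (dir k) x] at this

/-- The tile of the pattern at a lattice cell. -/
def patternTile (x : ℤ × ℤ) : Placement := tile (orient x) x

lemma patternTile_injective : Function.Injective patternTile := fun _ _ h => (tile_injective h).2

lemma disjoint_patternTile_top {x w : ℤ × ℤ} (hw : w ≠ 0) :
    Disjoint (interior (patternTile x).top) (interior (patternTile (x + w)).top) := by
  rw [patternTile, patternTile, tile, tile, disjoint_top_iff]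
  by_contra hn
  obtain ⟨c, h1, h2⟩ := Finset.not_disjoint_iff.1 hn
  obtain ⟨c, hc, h1, h2⟩ := (not_disjoint_iff_exists_shift (fun _ h => .inl h) (val_lt _) x w).1
    ⟨c, mem_tile_top.1 h1, mem_tile_top.1 h2⟩
  obtain ⟨k, rfl⟩ := (eq_zero_or_dir_of_common (.inl rfl) (.inl rfl) h1 h2).resolve_left hw
  refine (top_top_check _ _ k).2 ?_ c hc ⟨h1, h2⟩
  rintro ⟨ha, hb⟩
  exact orient_matched x k (ha.trans hb.symm)

lemma disjoint_patternTile_bottom {x w : ℤ × ℤ} (hw : w ≠ 0) :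
    Disjoint (interior (patternTile x).bottom) (interior (patternTile (x + w)).bottom) := by
  rw [patternTile, patternTile, tile, tile, gridPlacement_bottom, gridPlacement_bottom,
    interior_region_disjoint]
  by_contra hn
  obtain ⟨c, h1, h2⟩ := Finset.not_disjoint_iff.1 hn
  obtain ⟨c, hc, h1, h2⟩ := (not_disjoint_iff_exists_shift (fun _ h => .inr h) (val_lt _) x w).1
    ⟨c, mem_tile_bottom.1 h1, mem_tile_bottom.1 h2⟩
  obtain ⟨k, rfl⟩ := (eq_zero_or_dir_of_common (.inr rfl) (.inr rfl) h1 h2).resolve_left hw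
  exact bottom_bottom_check _ _ k (orient_matched x k) c hc ⟨h1, h2⟩

/-- A tile of the pattern obstructs the tile behind it only. -/
lemma not_obstructs_patternTile {x y : ℤ × ℤ} (hne : y ≠ x) (hn : y ≠ next x) :
    ¬ Obstructs (patternTile y) (patternTile x) := by
  obtain ⟨w, rfl⟩ : ∃ w, y = x + w := ⟨y - x, by abel⟩
  rw [patternTile, patternTile, obstructs_iff_exists]
  intro h
  obtain ⟨c, hc, h1, h2⟩ := h
  obtain ⟨k, rfl⟩ := (eq_zero_or_dir_of_common (.inr rfl) (.inl rfl) h1 h2).resolve_left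
    fun h => hne (by rw [h, add_zero])
  exact hn (by rw [next, (bottom_top_check _ _ _ (orient_matched x k)).1 ⟨c, hc, h1, h2⟩])

theorem isTiling_patternTile : IsTiling (Set.range patternTile) where
  cover := by
    refine Set.eq_univ_of_forall fun z => ?_
    obtain ⟨c, hc⟩ := exists_mem_triangle z
    obtain ⟨x, hx⟩ := exists_inMove_inTop c
    refine Set.mem_iUnion₂.2 ⟨_, ⟨x, rfl⟩, ?_⟩
    rw [patternTile, tile, gridPlacement_top]
    exact Set.mem_iUnion₂.2 ⟨c, mem_tile_top.2 hx, hc⟩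
  top_disjoint := by
    rintro _ ⟨x, rfl⟩ _ ⟨y, rfl⟩ hne
    obtain ⟨w, rfl⟩ : ∃ w, y = x + w := ⟨y - x, by abel⟩
    exact disjoint_patternTile_top fun h => hne (by rw [h, add_zero])
  bottom_disjoint := by
    rintro _ ⟨x, rfl⟩ _ ⟨y, rfl⟩ hne
    obtain ⟨w, rfl⟩ : ∃ w, y = x + w := ⟨y - x, by abel⟩
    exact disjoint_patternTile_bottom fun h => hne (by rw [h, add_zero])
  laid := by
    classical
    intro F hF
    rw [← Set.image_univ] at hF
    obtain ⟨s, -, rfl⟩ := Finset.subset_set_image_iff.1 hF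
    obtain ⟨l, hnd, hmem, hpw⟩ := exists_list_next s
    refine ⟨l.map patternTile, hnd.map patternTile_injective, fun x => ?_, ?_⟩
    · simp only [List.mem_map, Finset.mem_image, hmem]
    · refine List.pairwise_map.2 ((hnd.and hpw).imp fun {x y} h => ?_)
      exact not_obstructs_patternTile h.1 h.2

end HexToo

end

theorem mainTheorem1 :
    (∃ T : Set HexToo.Placement, HexToo.IsTiling T) ∧
      ∀ T : Set HexToo.Placement, HexToo.IsTiling T →
        ∀ p : ℂ, p ≠ 0 → ¬ HexToo.IsPeriod T p :=
  ⟨⟨_, HexToo.isTiling_patternTile⟩, fun _ hT _ hp => hT.not_isPeriod hp⟩
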